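/- Let $n,r\ge 0$ and let $E\to\mathbb R^n$ be a real or complex vector bundle of rank $r$ with a fibre metric, trivialised by a global orthonormal frame. A (smooth, metric) connection on $E$ is $\nabla=d+\Gamma$, with $\Gamma=\sum_i\Gamma_i\,dx^i$ smooth and each $\Gamma_i(x)$ skew-symmetric (resp. skew-Hermitian). Its curvature is $F_{ij}=\partial_i\Gamma_j-\partial_j\Gamma_i+\Gamma_i\Gamma_j-\Gamma_j\Gamma_i$. Put $|F|^2=\sum_{i,j}\sum_{\alpha,\beta}|(F_{ij})^{\beta}_{\alpha}|^2$, $(D^*F)_j=-\sum_i\nabla_iF_{ij}=-\sum_i(\partial_iF_{ij}+[\Gamma_i,F_{ij}])$ and $(V\lrcorner F)_j=\sum_iV^iF_{ij}$ for a vector field $V$. For $x_0\in\mathbb R^n$ and $t_0>0$ set $$\mathcal F_{x_0,t_0}(\nabla)=t_0^2\int_{\mathbb R^n}|F_\nabla|^2\,G_{x_0,t_0}\,dV,\qquad G_{x_0,t_0}(x)=(4\pi t_0)^{-n/2}e^{-|x-x_0|^2/4t_0}.$$ Let $\nabla$ have polynomial energy growth about some point $y\in\mathbb R^n$: there is a polynomial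 $p$ with $\int_{B_y(\rho)}|F_\nabla|^2\,dV\le p(\rho)$ for all $\rho>0$. A variation of $(\nabla,x_0,t_0)$ consists of one-parameter families $\nabla_s$ of connections (with $\Gamma_s(x)$ smooth in $(s,x)$), $x_s\in\mathbb R^n$ and $t_s>0$ (smooth in $s\in\mathbb R$), equal to $\nabla,x_0,t_0$ at $s=0$, such that the connection varies in a weighted Sobolev sense: there are $\varepsilon>0$, $T>t_0$ and a function $h$ with $\int_{\mathbb R^n}h\,e^{-|x-x_0|^2/4T}\,dV<\infty$ and $|\partial_s\Gamma_s|^2\le h$, $|\partial_sF_{\nabla_s}|^2\le h$ on $\mathbb R^n$ for $|s|<\varepsilon$. (All smooth variations of the connection supported in a fixed compact set are allowed.) The triple $(\nabla,x_0,t_0)$ is a critical point of the $\mathcal F$-functional if, for every variation, $\frac{d}{ds}\big|_{s=0}\mathcal F_{x_s,t_s}(\nabla_s)$ exists and equals $0$. Then $(\nabla,x_0,t_0)$ is a critical point of the $\mathcal F$-functional if and only if $\nabla$ is an $(x_0,t_0)$-soliton, that is, $$D^*F+\frac{x-x_0}{2t_0}\lrcorner F=0\quad\text{on }\mathbb R^n.$$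 -/

import Mathlib

open MeasureTheory
open scoped ContDiff Matrix

noncomputable section

namespace YangMillsSoliton

/-- Euclidean space `ℝⁿ`. -/
abbrev Rn (n : ℕ) : Type := EuclideanSpace ℝ (Fin n)

/-- `End E`-valued one-forms on `ℝⁿ`, in a global orthonormal frame of the rank `r` bundle `E`:
`B x i` is the matrix of `B(∂ᵢ)` at `x`. -/
abbrev OneForm (𝕜 : Type*) (n r : ℕ) : Type _ := Rn n → Fin n → Matrix (Fin r) (Fin r) 𝕜

/-- Components `η x i j` of `End E`-valued two-tensors on `ℝⁿ`. -/
abbrev TwoForm (𝕜 : Type*) (n r : ℕ) : Type _ :=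
  Rn n → Fin n → Fin n → Matrix (Fin r) (Fin r) 𝕜

/-- A smooth metric connection on the (trivialised) rank `r` bundle `E` over `ℝⁿ` with its fibre
metric, given by its coefficient matrix `Γ = Γᵢ dxⁱ` in an orthonormal frame:
`∇ = d + Γ`, with `Γᵢ(x)` skew-symmetric (`𝕜 = ℝ`) or skew-Hermitian (`𝕜 = ℂ`). -/
structure Connection (𝕜 : Type*) [RCLike 𝕜] (n r : ℕ) where
  coeff : OneForm 𝕜 n r
  smooth : ∀ (i : Fin n) (β α : Fin r), ContDiff ℝ ∞ (fun x : Rn n => coeff x i β α)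
  skew : ∀ (x : Rn n) (i : Fin n), (coeff x i)ᴴ = -coeff x i

section

variable {𝕜 : Type*} [RCLike 𝕜] {n r : ℕ}

/-- The partial derivative `∂ᵢ A` of a matrix-valued function, entry by entry. -/
def pderiv (i : Fin n) (A : Rn n → Matrix (Fin r) (Fin r) 𝕜) (x : Rn n) :
    Matrix (Fin r) (Fin r) 𝕜 :=
  Matrix.of fun β α => fderiv ℝ (fun y => A y β α) x (EuclideanSpace.single i 1)

/-- The curvature `Fᵢⱼ = ∂ᵢ Γⱼ - ∂ⱼ Γᵢ + Γᵢ Γⱼ - Γⱼ Γᵢ`. -/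
def Connection.curvature (D : Connection 𝕜 n r) : TwoForm 𝕜 n r := fun x i j =>
  pderiv i (fun y => D.coeff y j) x - pderiv j (fun y => D.coeff y i) x
    + D.coeff x i * D.coeff x j - D.coeff x j * D.coeff x i

/-- The covariant derivative `∇ᵢ A = ∂ᵢ A + [Γᵢ, A]` on sections of `End E`. As `ℝⁿ` is flat, it
also computes the covariant derivative of `End E`-valued tensors component by component. -/
def Connection.covDeriv (D : Connection 𝕜 n r) (i : Fin n)
    (A : Rn n → Matrix (Fin r) (Fin r) 𝕜) (x : Rn n) : Matrix (Fin r) (Fin r) 𝕜 :=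
  pderiv i A x + (D.coeff x i * A x - A x * D.coeff x i)

/-- `(D^* η)ⱼ = (∇^* η)ⱼ = - ∑ᵢ ∇ᵢ ηᵢⱼ`, the formal adjoint of `∇` applied to `η`. -/
def Connection.adjoint (D : Connection 𝕜 n r) (η : TwoForm 𝕜 n r) : OneForm 𝕜 n r := fun x j =>
  -∑ i, D.covDeriv i (fun y => η y i j) x

/-- Interior product with a vector field: `(V ⌟ η)ⱼ = ∑ᵢ Vⁱ ηᵢⱼ`. -/
def hook (V : Rn n → Rn n) (η : TwoForm 𝕜 n r) : OneForm 𝕜 n r := fun x j =>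
  ∑ i, V x i • η x i j

/-- The `(x₀,t₀)`-soliton operator `D^*F + ((x - x₀) / 2t₀) ⌟ F`. -/
def solitonOperator (x₀ : Rn n) (t₀ : ℝ) (D : Connection 𝕜 n r) : OneForm 𝕜 n r := fun x j =>
  D.adjoint D.curvature x j + hook (fun y => (1 / (2 * t₀)) • (y - x₀)) D.curvature x j

/-- `D` is an `(x₀,t₀)`-soliton. -/
def IsSoliton (D : Connection 𝕜 n r) (x₀ : Rn n) (t₀ : ℝ) : Prop :=
  ∀ (x : Rn n) (j : Fin n), solitonOperator x₀ t₀ D x j = 0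

/-- The squared norm `-tr(A²)` of a skew matrix, i.e. the sum of its squared entries. -/
def matNormSq (A : Matrix (Fin r) (Fin r) 𝕜) : ℝ := ∑ β, ∑ α, ‖A β α‖ ^ 2

/-- `|B|²` for the value of an `End E`-valued one-form at a point. -/
def normSqOne (B : Fin n → Matrix (Fin r) (Fin r) 𝕜) : ℝ := ∑ i, matNormSq (B i)

/-- `|η|²` for the value of an `End E`-valued two-tensor at a point. -/
def normSqTwo (η : Fin n → Fin n → Matrix (Fin r) (Fin r) 𝕜) : ℝ := ∑ i, ∑ j, matNormSq (η i j)

/-- The kernel `G₀(x) = (4πt₀)^(-n/2) exp(-|x - x₀|² / 4t₀)`. -/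
def kernelG (x₀ : Rn n) (t₀ : ℝ) (x : Rn n) : ℝ :=
  (4 * Real.pi * t₀) ^ (-(n : ℝ) / 2) * Real.exp (-‖x - x₀‖ ^ 2 / (4 * t₀))

/-- The `𝓕`-functional `t₀² ∫ |F|² G₀ dV`. -/
def functionalF (D : Connection 𝕜 n r) (x₀ : Rn n) (t₀ : ℝ) : ℝ :=
  t₀ ^ 2 * ∫ x : Rn n, normSqTwo (D.curvature x) * kernelG x₀ t₀ x

/-- Polynomial energy growth about `y`. -/
def PolynomialEnergyGrowth (D : Connection 𝕜 n r) (y : Rn n) : Prop :=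
  ∃ p : Polynomial ℝ, ∀ ρ : ℝ, 0 < ρ →
    ∫ x in Metric.ball y ρ, normSqTwo (D.curvature x) ≤ p.eval ρ

/-- The `s`-derivative of the coefficient matrix along a family of connections. -/
def velocity (D : ℝ → Connection 𝕜 n r) (s : ℝ) : OneForm 𝕜 n r := fun x i =>
  Matrix.of fun β α => deriv (fun σ => (D σ).coeff x i β α) s

/-- The `s`-derivative of the curvature along a family of connections. -/
def curvatureVelocity (D : ℝ → Connection 𝕜 n r) (s : ℝ) : TwoForm 𝕜 n r := fun x i j =>
  Matrix.of fun β α => deriv (fun σ => (D σ).curvature x i j β α) s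

/-- A variation `(∇ₛ, xₛ, tₛ)` of `(∇, x₀, t₀)`: smooth one-parameter families of connections,
of points and of positive real numbers. The connection varies in a weighted Sobolev sense: for `s`
near `0`, `|∂ₛΓₛ|²` and `|∂ₛFₛ|²` are bounded by one function `h` that is integrable against
`exp(-|x - x₀|² / 4T)` for some `T > t₀`. (All variations that are supported in a fixed compact
set satisfy this.) -/
structure Variation (D : Connection 𝕜 n r) (x₀ : Rn n) (t₀ : ℝ) where
  conn : ℝ → Connection 𝕜 n r
  point : ℝ → Rn n
  time : ℝ → ℝ
  conn_zero : conn 0 = D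
  point_zero : point 0 = x₀
  time_zero : time 0 = t₀
  conn_smooth : ∀ (i : Fin n) (β α : Fin r),
    ContDiff ℝ ∞ (fun q : ℝ × Rn n => (conn q.1).coeff q.2 i β α)
  point_smooth : ContDiff ℝ ∞ point
  time_smooth : ContDiff ℝ ∞ time
  time_pos : ∀ s, 0 < time s
  admissible : ∃ (ε T : ℝ) (h : Rn n → ℝ), 0 < ε ∧ t₀ < T ∧
    Integrable (fun x => h x * Real.exp (-‖x - x₀‖ ^ 2 / (4 * T))) ∧
    ∀ s, |s| < ε → ∀ x, normSqOne (velocity conn s x) ≤ h x ∧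
      normSqTwo (curvatureVelocity conn s x) ≤ h x

/-- `(∇, x₀, t₀)` is a critical point of the `𝓕`-functional: along every variation the first
derivative at `s = 0` exists and vanishes. -/
def IsCriticalPoint (D : Connection 𝕜 n r) (x₀ : Rn n) (t₀ : ℝ) : Prop :=
  ∀ v : Variation D x₀ t₀,
    HasDerivAt (fun s => functionalF (v.conn s) (v.point s) (v.time s)) 0 0

end

end YangMillsSoliton

end

/-! Write S for `solitonOperator`, B for the velocity of the connection, w and τ for the velocities
of centre and scale at s = 0, and G for the kernel.

Since ∂ₛF is the exterior covariant derivative of B, and since ∂ᵢG = -(x - x₀)ᵢ G / (2t₀),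
integrating ⟨F, ∂ₛF⟩G by parts against the Gaussian weight produces exactly S: the connection
contributes 4t₀² ∫⟨S, B⟩G to the first variation. The remaining terms involve only ∫|F|²G with
weights that are polynomial in x, coming from w and τ.

If the triple is critical, fix x₀ and t₀ and take B = φS with a bump function φ. Then ∫φ|S|²G = 0,
which forces S = 0 where φ = 1.

Conversely, S = 0 kills the connection term, but the terms in w and τ must also vanish. They do by a
Pohozaev-type identity. For an affine field V = a + c(x - x₀), the second Bianchi identity and S = 0
show that the field Vⁱ|F|²G - 4⟨Fᵢ·, V⌟F⟩G has divergence (c(n - 4) - ⟨V, x - x₀⟩/(2t₀))|F|²G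
(`Connection.divergence_stressEnergy`), whose integral is zero. With a = -t₀²w and c = -t₀τ/2 this
integrand is the one in the first variation.

The analysis rests on three facts. Polynomial energy growth makes |F|² integrable against every
Gaussian (`PolynomialEnergyGrowth.integrable_gaussian`). A slightly wider Gaussian absorbs quadratic
weights and small changes of centre and scale (`exists_kernelG_bound`), which permits
differentiation under the integral (`Variation.hasDerivAt_integral`). The divergence theorem holds
for integrable fields with integrable divergence (`integral_divergence_eq_zero`). -/

noncomputable section

namespace YangMillsSoliton

/-! ### Matrix-valued functions, covariant derivatives and the Bianchi identity. -/

section MatrixFields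

variable {𝕜 : Type*} [RCLike 𝕜] {n r : ℕ}

/-- The real inner product `Re tr (A Bᴴ)` on matrices, as a bilinear form. -/
def ip : Matrix (Fin r) (Fin r) 𝕜 →ₗ[ℝ] Matrix (Fin r) (Fin r) 𝕜 →ₗ[ℝ] ℝ :=
  LinearMap.mk₂ ℝ (fun A B => RCLike.re (A * Bᴴ).trace)
    (fun A A' B => by simp [add_mul])
    (fun c A B => by simp [RCLike.smul_re])
    (fun A B B' => by simp [mul_add])
    (fun c A B => by simp [Matrix.conjTranspose_smul, RCLike.smul_re])

theorem ip_apply (A B : Matrix (Fin r) (Fin r) 𝕜) : ip A B = RCLike.re (A * Bᴴ).trace := rfl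

theorem ip_eq_sum (A B : Matrix (Fin r) (Fin r) 𝕜) :
    ip A B = ∑ β, ∑ α, RCLike.re (A β α * star (B β α)) := by
  simp [ip_apply, Matrix.trace, Matrix.mul_apply]

theorem ip_comm (A B : Matrix (Fin r) (Fin r) 𝕜) : ip A B = ip B A := by
  simp only [ip_eq_sum]
  refine Finset.sum_congr rfl fun β _ => Finset.sum_congr rfl fun α _ => ?_
  rw [← RCLike.conj_re, map_mul, mul_comm]
  simp

theorem ip_self (A : Matrix (Fin r) (Fin r) 𝕜) : ip A A = matNormSq A := by
  simp only [ip_eq_sum, matNormSq]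
  refine Finset.sum_congr rfl fun β _ => Finset.sum_congr rfl fun α _ => ?_
  have := RCLike.mul_conj (A β α)
  rw [RCLike.star_def, this]
  norm_cast

theorem matNormSq_nonneg (A : Matrix (Fin r) (Fin r) 𝕜) : 0 ≤ matNormSq A := by
  unfold matNormSq; positivity

theorem matNormSq_eq_zero {A : Matrix (Fin r) (Fin r) 𝕜} (h : matNormSq A = 0) : A = 0 := by
  unfold matNormSq at h
  rw [Finset.sum_eq_zero_iff_of_nonneg (fun _ _ => by positivity)] at h
  ext β α
  have h1 := h β (Finset.mem_univ _)
  rw [Finset.sum_eq_zero_iff_of_nonneg (fun _ _ => by positivity)] at h1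
  simpa using h1 α (Finset.mem_univ _)

/-- Expand |A ± B|² ≥ 0. This additive form of Cauchy-Schwarz is all that the domination arguments
need. -/
theorem abs_ip_le (A B : Matrix (Fin r) (Fin r) 𝕜) :
    2 * |ip A B| ≤ matNormSq A + matNormSq B := by
  have h1 := matNormSq_nonneg (A + B)
  have h2 := matNormSq_nonneg (A - B)
  simp only [← ip_self, map_add, map_sub, LinearMap.add_apply, LinearMap.sub_apply,
    ip_comm B A] at h1 h2 ⊢
  rcases abs_cases (ip A B) with ⟨h, _⟩ | ⟨h, _⟩ <;> rw [h] <;> linarith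

/-- By cyclicity of the trace, the commutator with a skew matrix is skew-adjoint. This is what makes
`covDeriv` compatible with `ip`. -/
theorem ip_commutator {S : Matrix (Fin r) (Fin r) 𝕜} (hS : Sᴴ = -S)
    (A B : Matrix (Fin r) (Fin r) 𝕜) :
    ip (S * A - A * S) B = -ip A (S * B - B * S) := by
  rw [ip_apply, ip_apply, ← map_neg]
  congr 1
  simp only [Matrix.conjTranspose_sub, Matrix.conjTranspose_mul, hS, sub_mul, mul_sub,
    Matrix.trace_sub, mul_neg, neg_mul, Matrix.trace_neg]
  rw [Matrix.mul_assoc S A, Matrix.trace_mul_comm S, Matrix.mul_assoc A S, Matrix.mul_assoc A]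
  ring

/-- Smoothness of a matrix-valued function, entry by entry. -/
def EntrySmooth (A : Rn n → Matrix (Fin r) (Fin r) 𝕜) : Prop :=
  ∀ β α, ContDiff ℝ ∞ fun x => A x β α

namespace EntrySmooth

variable {A B : Rn n → Matrix (Fin r) (Fin r) 𝕜}

theorem differentiableAt (hA : EntrySmooth A) (β α : Fin r) (x : Rn n) :
    DifferentiableAt ℝ (fun y => A y β α) x :=
  (hA β α).differentiable (by simp) x

theorem add (hA : EntrySmooth A) (hB : EntrySmooth B) : EntrySmooth fun x => A x + B x :=
  fun β α => (hA β α).add (hB β α)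

theorem sub (hA : EntrySmooth A) (hB : EntrySmooth B) : EntrySmooth fun x => A x - B x :=
  fun β α => (hA β α).sub (hB β α)

theorem neg (hA : EntrySmooth A) : EntrySmooth fun x => -A x :=
  fun β α => (hA β α).neg

theorem smul {φ : Rn n → ℝ} (hφ : ContDiff ℝ ∞ φ) (hA : EntrySmooth A) :
    EntrySmooth fun x => φ x • A x :=
  fun β α => hφ.smul (hA β α)

theorem mul (hA : EntrySmooth A) (hB : EntrySmooth B) : EntrySmooth fun x => A x * B x :=
  fun β α => by
    simp only [Matrix.mul_apply]
    exact ContDiff.sum fun γ _ => (hA β γ).mul (hB γ α)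

theorem sum {ι : Type*} {s : Finset ι} {C : ι → Rn n → Matrix (Fin r) (Fin r) 𝕜}
    (hC : ∀ i ∈ s, EntrySmooth (C i)) : EntrySmooth fun x => ∑ i ∈ s, C i x :=
  fun β α => by
    simp only [Matrix.sum_apply]
    exact ContDiff.sum fun i hi => hC i hi β α

theorem pderiv (hA : EntrySmooth A) (i : Fin n) : EntrySmooth (pderiv i A) :=
  fun β α => ((hA β α).fderiv_right (m := ∞) (by simp)).clm_apply contDiff_const

theorem ip (hA : EntrySmooth A) (hB : EntrySmooth B) : ContDiff ℝ ∞ fun x => ip (A x) (B x) := by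
  simp only [ip_eq_sum]
  exact ContDiff.sum fun β _ => ContDiff.sum fun α _ =>
    (RCLike.reCLM (K := 𝕜)).contDiff.comp ((hA β α).mul
      ((starL' ℝ (A := 𝕜)).toContinuousLinearMap.contDiff.comp (hB β α)))

end EntrySmooth

section pderiv

variable {A B : Rn n → Matrix (Fin r) (Fin r) 𝕜}

theorem pderiv_add (hA : EntrySmooth A) (hB : EntrySmooth B) (i : Fin n) (x : Rn n) :
    pderiv i (fun y => A y + B y) x = pderiv i A x + pderiv i B x := by
  ext β α
  simp [pderiv, fderiv_fun_add (hA.differentiableAt β α x) (hB.differentiableAt β α x)]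

theorem pderiv_sub (hA : EntrySmooth A) (hB : EntrySmooth B) (i : Fin n) (x : Rn n) :
    pderiv i (fun y => A y - B y) x = pderiv i A x - pderiv i B x := by
  ext β α
  simp [pderiv, fderiv_fun_sub (hA.differentiableAt β α x) (hB.differentiableAt β α x)]

theorem pderiv_mul (hA : EntrySmooth A) (hB : EntrySmooth B) (i : Fin n) (x : Rn n) :
    pderiv i (fun y => A y * B y) x = pderiv i A x * B x + A x * pderiv i B x := by
  ext β α
  simp only [pderiv, Matrix.of_apply, Matrix.mul_apply, Matrix.add_apply]
  rw [fderiv_fun_sum fun γ _ => (hA.differentiableAt β γ x).fun_mul (hB.differentiableAt γ α x)]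
  rw [_root_.sum_apply, ← Finset.sum_add_distrib]
  refine Finset.sum_congr rfl fun γ _ => ?_
  rw [fderiv_fun_mul (hA.differentiableAt β γ x) (hB.differentiableAt γ α x)]
  simp only [_root_.add_apply, _root_.smul_apply, smul_eq_mul]
  ring

theorem pderiv_conjTranspose (A : Rn n → Matrix (Fin r) (Fin r) 𝕜) (i : Fin n) (x : Rn n) :
    pderiv i (fun y => (A y)ᴴ) x = (pderiv i A x)ᴴ := by
  ext β α
  simp only [pderiv, Matrix.of_apply, Matrix.conjTranspose_apply, fderiv_star]
  rfl

theorem pderiv_congr {x : Rn n} (h : A =ᶠ[nhds x] B) (i : Fin n) :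
    pderiv i A x = pderiv i B x := by
  ext β α
  have : (fun y => A y β α) =ᶠ[nhds x] fun y => B y β α := h.mono fun y hy => congrFun₂ hy β α
  simp [pderiv, this.fderiv_eq]

theorem fderiv_fderiv_comm {E F : Type*} [NormedAddCommGroup E] [NormedSpace ℝ E]
    [NormedAddCommGroup F] [NormedSpace ℝ F] {f : E → F} (hf : ContDiff ℝ ∞ f) (x v w : E) :
    fderiv ℝ (fun y => fderiv ℝ f y v) x w = fderiv ℝ (fun y => fderiv ℝ f y w) x v := by
  have hd : DifferentiableAt ℝ (fderiv ℝ f) x :=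
    (hf.fderiv_right (m := ∞) (by simp)).differentiable (by simp) x
  rw [fderiv_clm_apply hd (differentiableAt_const v),
    fderiv_clm_apply hd (differentiableAt_const w)]
  have hs : IsSymmSndFDerivAt ℝ f x := hf.contDiffAt.isSymmSndFDerivAt
    (by rw [minSmoothness_of_isRCLikeNormedField]; exact WithTop.coe_le_coe.2 le_top)
  simpa using hs w v

theorem pderiv_comm (hA : EntrySmooth A) (i j : Fin n) (x : Rn n) :
    pderiv i (pderiv j A) x = pderiv j (pderiv i A) x := by
  ext β α
  exact fderiv_fderiv_comm (hA β α) x _ _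

theorem fderiv_ip (hA : EntrySmooth A) (hB : EntrySmooth B) (i : Fin n) (x : Rn n) :
    fderiv ℝ (fun y => ip (A y) (B y)) x (EuclideanSpace.single i 1) =
      ip (pderiv i A x) (B x) + ip (A x) (pderiv i B x) := by
  simp only [ip_eq_sum]
  have hB' : ∀ β α, HasFDerivAt (fun y => star (B y β α)) _ x :=
    fun β α => (hB.differentiableAt β α x).hasFDerivAt.star
  have h : ∀ β α, HasFDerivAt (fun y => RCLike.re (A y β α * star (B y β α))) _ x :=
    fun β α => RCLike.reCLM.hasFDerivAt.comp x
      ((hA.differentiableAt β α x).hasFDerivAt.mul (hB' β α))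
  rw [(HasFDerivAt.fun_sum fun β _ => HasFDerivAt.fun_sum fun α _ => h β α).fderiv]
  simp only [_root_.sum_apply, ← Finset.sum_add_distrib]
  refine Finset.sum_congr rfl fun β _ => Finset.sum_congr rfl fun α _ => ?_
  simp only [pderiv, Matrix.of_apply, ContinuousLinearMap.comp_apply,
    _root_.add_apply, _root_.smul_apply, smul_eq_mul, RCLike.reCLM_apply,
    map_add]
  rw [add_comm, mul_comm (star _)]
  rfl

end pderiv

namespace Connection

variable (D : Connection 𝕜 n r)

theorem entrySmooth (i : Fin n) : EntrySmooth fun x => D.coeff x i := D.smooth i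

theorem curvature_entrySmooth (i j : Fin n) : EntrySmooth fun x => D.curvature x i j :=
  ((((D.entrySmooth j).pderiv i).sub ((D.entrySmooth i).pderiv j)).add
    ((D.entrySmooth i).mul (D.entrySmooth j))).sub ((D.entrySmooth j).mul (D.entrySmooth i))

theorem covDeriv_entrySmooth {A : Rn n → Matrix (Fin r) (Fin r) 𝕜} (hA : EntrySmooth A)
    (i : Fin n) : EntrySmooth (D.covDeriv i A) :=
  (hA.pderiv i).add (((D.entrySmooth i).mul hA).sub (hA.mul (D.entrySmooth i)))

theorem curvature_antisymm (x : Rn n) (i j : Fin n) :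
    D.curvature x i j = -D.curvature x j i := by
  simp only [curvature]; abel

/-- Together with `covDeriv_skew` this makes the soliton operator skew, hence an admissible
direction in the space of metric connections. -/
theorem curvature_skew (x : Rn n) (i j : Fin n) :
    (D.curvature x i j)ᴴ = -D.curvature x i j := by
  have h : ∀ i j, (pderiv i (fun y => D.coeff y j) x)ᴴ = -pderiv i (fun y => D.coeff y j) x := by
    intro i j
    rw [← pderiv_conjTranspose]
    simp only [D.skew]
    ext β α
    simp [pderiv]
  simp only [curvature, Matrix.conjTranspose_sub, Matrix.conjTranspose_add,
    Matrix.conjTranspose_mul, h, D.skew]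
  noncomm_ring

theorem covDeriv_skew {A : Rn n → Matrix (Fin r) (Fin r) 𝕜} (hA : ∀ x, (A x)ᴴ = -A x)
    (i : Fin n) (x : Rn n) : (D.covDeriv i A x)ᴴ = -D.covDeriv i A x := by
  have h : (pderiv i A x)ᴴ = -pderiv i A x := by
    rw [← pderiv_conjTranspose]
    simp only [hA]
    ext β α
    simp [pderiv]
  simp only [covDeriv, Matrix.conjTranspose_sub, Matrix.conjTranspose_add,
    Matrix.conjTranspose_mul, h, D.skew, hA]
  noncomm_ring

theorem covDeriv_neg (A : Rn n → Matrix (Fin r) (Fin r) 𝕜) (i : Fin n) (x : Rn n) :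
    D.covDeriv i (fun y => -A y) x = -D.covDeriv i A x := by
  have : pderiv i (fun y => -A y) x = -pderiv i A x := by ext β α; simp [pderiv]
  rw [covDeriv, covDeriv, this]
  noncomm_ring

/-- Compatibility of `∇` with the fibre metric. -/
theorem fderiv_ip_eq_covDeriv {A B : Rn n → Matrix (Fin r) (Fin r) 𝕜} (hA : EntrySmooth A)
    (hB : EntrySmooth B) (i : Fin n) (x : Rn n) :
    fderiv ℝ (fun y => ip (A y) (B y)) x (EuclideanSpace.single i 1) =
      ip (D.covDeriv i A x) (B x) + ip (A x) (D.covDeriv i B x) := by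
  rw [fderiv_ip hA hB, covDeriv, covDeriv]
  have h := ip_commutator (D.skew x i) (A x) (B x)
  simp only [map_add, LinearMap.add_apply]
  linarith

/-- The second Bianchi identity. -/
theorem bianchi (i j k : Fin n) (x : Rn n) :
    D.covDeriv i (fun y => D.curvature y j k) x + D.covDeriv j (fun y => D.curvature y k i) x
      + D.covDeriv k (fun y => D.curvature y i j) x = 0 := by
  have hs := fun i => D.entrySmooth i
  have h : ∀ i j k, pderiv i (fun y => D.curvature y j k) x =
      pderiv i (pderiv j fun y => D.coeff y k) x - pderiv i (pderiv k fun y => D.coeff y j) x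
      + (pderiv i (fun y => D.coeff y j) x * D.coeff x k
        + D.coeff x j * pderiv i (fun y => D.coeff y k) x)
      - (pderiv i (fun y => D.coeff y k) x * D.coeff x j
        + D.coeff x k * pderiv i (fun y => D.coeff y j) x) := by
    intro i j k
    simp only [curvature]
    rw [pderiv_sub ((((hs k).pderiv j).sub ((hs j).pderiv k)).add ((hs j).mul (hs k)))
      ((hs k).mul (hs j)), pderiv_add (((hs k).pderiv j).sub ((hs j).pderiv k))
      ((hs j).mul (hs k)), pderiv_sub ((hs k).pderiv j) ((hs j).pderiv k),
      pderiv_mul (hs j) (hs k), pderiv_mul (hs k) (hs j)]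
  simp only [covDeriv, h]
  simp only [curvature]
  -- Second derivatives of Γ cancel in pairs by symmetry; what remains is an identity in the
  -- noncommutative ring of matrices.
  rw [pderiv_comm (hs k) j i, pderiv_comm (hs j) k i, pderiv_comm (hs i) k j]
  noncomm_ring

end Connection

end MatrixFields

/-! ### The divergence theorem on the whole space. -/

section Divergence

variable {n : ℕ}

/-- Cutoff functions: values in `[0,1]`, eventually `1` at each point, with gradients tending
uniformly to zero. -/
theorem exists_cutoff (n : ℕ) : ∃ (η : ℕ → Rn n → ℝ) (C : ℝ), (∀ k, ContDiff ℝ ∞ (η k)) ∧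
    (∀ k, HasCompactSupport (η k)) ∧ (∀ k x, |η k x| ≤ 1) ∧
    (∀ x, ∀ᶠ k in Filter.atTop, η k x = 1) ∧
    ∀ k x i, |fderiv ℝ (η k) x (EuclideanSpace.single i 1)| ≤ C / (k + 1) := by
  let φ : ContDiffBump (0 : Rn n) := ⟨1, 2, one_pos, one_lt_two⟩
  have hφ : ContDiff ℝ ∞ φ := φ.contDiff
  obtain ⟨C, hC⟩ := (hφ.continuous_fderiv (by simp)).bounded_above_of_compact_support
    (φ.hasCompactSupport.fderiv (𝕜 := ℝ))
  have hk : ∀ k : ℕ, (0 : ℝ) < (k : ℝ) + 1 := fun k => by positivity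
  -- Rescaling one bump by the factor k + 1 divides its gradient by k + 1. The shift by one avoids
  -- division by zero at k = 0.
  refine ⟨fun k x => φ (((k : ℝ) + 1)⁻¹ • x), C, fun k => ?_, fun k => ?_, fun k x => ?_,
    fun x => ?_, fun k x i => ?_⟩
  · exact hφ.comp (contDiff_const_smul _)
  · exact φ.hasCompactSupport.comp_smul (inv_ne_zero (hk k).ne')
  · rw [abs_of_nonneg φ.nonneg]; exact φ.le_one
  · obtain ⟨N, hN⟩ := exists_nat_ge ‖x‖
    filter_upwards [Filter.eventually_ge_atTop N] with k hkN
    apply φ.one_of_mem_closedBall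
    rw [mem_closedBall_zero_iff, norm_smul, norm_inv, Real.norm_of_nonneg (hk k).le,
      inv_mul_le_iff₀ (hk k)]
    have : (N : ℝ) ≤ k := by exact_mod_cast hkN
    change _ ≤ _ * (1 : ℝ)
    linarith
  · have hd : HasFDerivAt (fun x : Rn n => φ (((k : ℝ) + 1)⁻¹ • x)) _ x :=
      (hφ.differentiable (by simp) (((k : ℝ) + 1)⁻¹ • x)).hasFDerivAt.comp x
        ((hasFDerivAt_id x).const_smul (((k : ℝ) + 1)⁻¹))
    rw [hd.fderiv]
    have h1 := (fderiv ℝ φ (((k : ℝ) + 1)⁻¹ • x)).le_opNorm (EuclideanSpace.single i 1)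
    rw [PiLp.norm_single, norm_one, mul_one, Real.norm_eq_abs] at h1
    simp only [ContinuousLinearMap.comp_apply, _root_.smul_apply, map_smul,
      smul_eq_mul, abs_mul, ContinuousLinearMap.id_apply]
    rw [abs_of_pos (inv_pos.2 (hk k)), div_eq_inv_mul]
    exact mul_le_mul_of_nonneg_left (h1.trans (hC _)) (inv_pos.2 (hk k)).le

/-- The divergence theorem on `ℝⁿ` for integrable vector fields with integrable divergence. -/
theorem integral_divergence_eq_zero {W : Fin n → Rn n → ℝ} (hW : ∀ i, ContDiff ℝ 1 (W i))
    (hint : ∀ i, Integrable (W i))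
    (hdiv : Integrable fun x => ∑ i, fderiv ℝ (W i) x (EuclideanSpace.single i 1)) :
    ∫ x, ∑ i, fderiv ℝ (W i) x (EuclideanSpace.single i 1) = 0 := by
  obtain ⟨η, C, hη, hηc, hη1, hηt, hηd⟩ := exists_cutoff n
  set div : Rn n → ℝ := fun x => ∑ i, fderiv ℝ (W i) x (EuclideanSpace.single i 1)
  have hWc : ∀ i, Continuous fun x => fderiv ℝ (W i) x (EuclideanSpace.single i 1) :=
    fun i => ((hW i).continuous_fderiv (by simp)).clm_apply continuous_const
  have hηc' : ∀ k i, Continuous fun x => fderiv ℝ (η k) x (EuclideanSpace.single i 1) :=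
    fun k i => ((hη k).continuous_fderiv (by simp)).clm_apply continuous_const
  have hi1 : ∀ k i, Integrable fun x => η k x * fderiv ℝ (W i) x (EuclideanSpace.single i 1) :=
    fun k i => ((hη k).continuous.mul (hWc i)).integrable_of_hasCompactSupport (hηc k).mul_right
  have hi2 : ∀ k i, Integrable fun x => fderiv ℝ (η k) x (EuclideanSpace.single i 1) * W i x :=
    fun k i => ((hηc' k i).mul (hW i).continuous).integrable_of_hasCompactSupport
      ((hηc k).fderiv_apply (𝕜 := ℝ) _).mul_right
  have hi3 : ∀ k i, Integrable fun x => η k x * W i x :=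
    fun k i => ((hη k).continuous.mul (hW i).continuous).integrable_of_hasCompactSupport
      (hηc k).mul_right
  have hparts : ∀ k, ∫ x, η k x * div x =
      -∑ i, ∫ x, fderiv ℝ (η k) x (EuclideanSpace.single i 1) * W i x := by
    intro k
    simp only [div, Finset.mul_sum]
    rw [integral_finsetSum _ fun i _ => hi1 k i, ← Finset.sum_neg_distrib]
    refine Finset.sum_congr rfl fun i _ => ?_
    exact integral_mul_fderiv_eq_neg_fderiv_mul_of_integrable (hi2 k i) (hi1 k i) (hi3 k i)
      (fun x _ => (hη k).differentiable (by simp) x)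
      (fun x _ => (hW i).differentiable (by simp) x)
  -- The same sequence has two limits: the full integral by dominated convergence, and zero because
  -- the gradients of the cutoffs decay uniformly while each `W i` is integrable.
  have hlim1 : Filter.Tendsto (fun k => ∫ x, η k x * div x) Filter.atTop (nhds (∫ x, div x)) := by
    refine tendsto_integral_of_dominated_convergence (fun x => ‖div x‖)
      (fun k => ((hη k).continuous.mul (continuous_finsetSum _ fun i _ => hWc i)).aestronglyMeasurable)
      hdiv.norm (fun k => Filter.Eventually.of_forall fun x => ?_)
      (Filter.Eventually.of_forall fun x => ?_)
    · rw [norm_mul]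
      exact mul_le_of_le_one_left (norm_nonneg _) (hη1 k x)
    · refine tendsto_const_nhds.congr' ?_
      filter_upwards [hηt x] with k hk
      rw [hk, one_mul]
  have hlim2 : Filter.Tendsto (fun k => ∫ x, η k x * div x) Filter.atTop (nhds 0) := by
    refine squeeze_zero_norm (a := fun k : ℕ => C / ((k : ℝ) + 1) * ∑ i, ∫ x, |W i x|)
      (fun k => ?_) ?_
    · rw [hparts, norm_neg, Finset.mul_sum]
      refine (norm_sum_le _ _).trans (Finset.sum_le_sum fun i _ => ?_)
      rw [← integral_const_mul]
      refine norm_integral_le_of_norm_le ((hint i).abs.const_mul _)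
        (Filter.Eventually.of_forall fun x => ?_)
      rw [norm_mul]
      exact mul_le_mul_of_nonneg_right (hηd k x i) (abs_nonneg _)
    · have : Filter.Tendsto (fun k : ℕ => C / ((k : ℝ) + 1)) Filter.atTop (nhds 0) :=
        tendsto_const_div_atTop_nhds_zero_nat C |>.comp (Filter.tendsto_add_atTop_nat 1) |>.congr
          fun k => by simp
      simpa using this.mul_const (∑ i, ∫ x, |W i x|)
  exact tendsto_nhds_unique hlim1 hlim2

end Divergence

/-! ### Gaussian comparison and integrability under polynomial growth. -/

section Gaussian

variable {n : ℕ}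

/-- Comparison of Gaussians with nearby centres and increasing scale. -/
theorem exists_gaussian_bound {T₁ T : ℝ} (hT₁ : 0 < T₁) (hT : T₁ < T) {R : ℝ}
    (x₀ : Rn n) : ∃ C, 0 ≤ C ∧ ∀ z t x, ‖z - x₀‖ ≤ R → 0 < t → t ≤ T₁ →
      (1 + ‖x - z‖ ^ 2) * Real.exp (-‖x - z‖ ^ 2 / (4 * t)) ≤
        C * Real.exp (-‖x - x₀‖ ^ 2 / (4 * T)) := by
  -- `T₁ (1 + κ) < T` for `κ = (T - T₁) / (2 T₁)`
  set κ : ℝ := (T - T₁) / (2 * T₁) with hκ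
  have hκ0 : 0 < κ := div_pos (by linarith) (by linarith)
  have hκT : T₁ * (1 + κ) = (T + T₁) / 2 := by rw [hκ]; field_simp; ring
  -- `a` is the decay left over after passing to the wider Gaussian, and it pays for the quadratic
  -- weight; `b` below is the cost of moving the centre.
  set a : ℝ := 1 / (4 * T₁) - (1 + κ) / (4 * T) with ha
  have hT0 : 0 < T := hT₁.trans hT
  have ha0 : 0 < a := by
    rw [ha, sub_pos, div_lt_div_iff₀ (by positivity) (by positivity)]
    nlinarith
  set b : ℝ := (1 + 1 / κ) * R ^ 2 / (4 * T) with hb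
  refine ⟨(1 + 1 / a) * Real.exp b, by positivity, fun z t x hz ht htT => ?_⟩
  have hR : 0 ≤ R := (norm_nonneg _).trans hz
  set u := ‖x - z‖ with hu
  have hu0 : 0 ≤ u := norm_nonneg _
  have htri : ‖x - x₀‖ ≤ u + R := by
    calc ‖x - x₀‖ = ‖(x - z) + (z - x₀)‖ := by congr 1; abel
      _ ≤ u + R := (norm_add_le _ _).trans (by gcongr)
  -- Young's inequality with parameter κ applied to the cross term 2uR.
  have hsq : ‖x - x₀‖ ^ 2 ≤ (1 + κ) * u ^ 2 + (1 + 1 / κ) * R ^ 2 := by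
    have h1 : ‖x - x₀‖ ^ 2 ≤ (u + R) ^ 2 := by gcongr
    have h2 : 0 ≤ κ * (u - R / κ) ^ 2 := by positivity
    have h3 : κ * (u - R / κ) ^ 2 = κ * u ^ 2 - 2 * u * R + 1 / κ * R ^ 2 := by
      field_simp; ring
    nlinarith
  have hexp : -u ^ 2 / (4 * t) ≤ -‖x - x₀‖ ^ 2 / (4 * T) + b + -(a * u ^ 2) := by
    have h1 : -u ^ 2 / (4 * t) ≤ -u ^ 2 / (4 * T₁) := by
      rw [neg_div, neg_div, neg_le_neg_iff]
      gcongr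
    have h2 : ‖x - x₀‖ ^ 2 / (4 * T) ≤ ((1 + κ) * u ^ 2 + (1 + 1 / κ) * R ^ 2) / (4 * T) := by
      gcongr
    have h3 : ((1 + κ) * u ^ 2 + (1 + 1 / κ) * R ^ 2) / (4 * T) = u ^ 2 / (4 * T₁) - a * u ^ 2 + b := by
      rw [ha, hb]; ring
    rw [neg_div] at h1 ⊢
    rw [neg_div] at h1 ⊢
    linarith
  have hpoly : (1 + u ^ 2) ≤ (1 + 1 / a) * Real.exp (a * u ^ 2) := by
    have h1 := Real.add_one_le_exp (a * u ^ 2)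
    have h2 : 1 + u ^ 2 ≤ (1 + 1 / a) * (a * u ^ 2 + 1) := by
      have : (1 + 1 / a) * (a * u ^ 2 + 1) = 1 + u ^ 2 + a * u ^ 2 + 1 / a := by
        field_simp; ring
      rw [this]
      have : 0 ≤ a * u ^ 2 + 1 / a := by positivity
      linarith
    exact h2.trans (by gcongr)
  calc (1 + u ^ 2) * Real.exp (-u ^ 2 / (4 * t))
      ≤ ((1 + 1 / a) * Real.exp (a * u ^ 2)) *
        Real.exp (-‖x - x₀‖ ^ 2 / (4 * T) + b + -(a * u ^ 2)) := by gcongr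
    _ = _ := by rw [Real.exp_add, Real.exp_add, Real.exp_neg]; field_simp

theorem summable_polynomial_mul_exp (p : Polynomial ℝ) {a : ℝ} (ha : 0 < a) :
    Summable fun k : ℕ => p.eval (k : ℝ) * Real.exp (-(a * k)) := by
  have h : ∀ k : ℕ, p.eval (k : ℝ) * Real.exp (-(a * k)) =
      ∑ i ∈ Finset.range (p.natDegree + 1), p.coeff i * ((k : ℝ) ^ i * Real.exp (-a) ^ k) := by
    intro k
    rw [Polynomial.eval_eq_sum_range, Finset.sum_mul, ← Real.exp_nat_mul]
    refine Finset.sum_congr rfl fun i _ => ?_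
    rw [mul_assoc]; congr 3; ring
  simp only [h]
  refine summable_sum fun i _ => Summable.mul_left _ ?_
  apply summable_pow_mul_geometric_of_norm_lt_one
  rw [Real.norm_of_nonneg (Real.exp_pos _).le]
  exact Real.exp_lt_one_iff.2 (by linarith)

/-- Functions of polynomial growth in the mean are integrable against Gaussians. -/
theorem integrable_mul_gaussian_of_growth {f : Rn n → ℝ} (hf : Continuous f) (hf0 : ∀ x, 0 ≤ f x)
    {y : Rn n} {p : Polynomial ℝ}
    (hp : ∀ ρ : ℝ, 0 < ρ → ∫ x in Metric.ball y ρ, f x ≤ p.eval ρ) {a : ℝ} (ha : 0 < a) :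
    Integrable fun x => f x * Real.exp (-(a * ‖x - y‖ ^ 2)) := by
  have hcont : Continuous fun x => f x * Real.exp (-(a * ‖x - y‖ ^ 2)) := by fun_prop
  refine ⟨hcont.aestronglyMeasurable, ?_⟩
  rw [hasFiniteIntegral_iff_ofReal
    (Filter.Eventually.of_forall fun x => mul_nonneg (hf0 x) (Real.exp_pos _).le)]
  have hball : ∀ k : ℕ, ∫⁻ x in Metric.ball y ((k : ℝ) + 1), ENNReal.ofReal (f x) ≤
      ENNReal.ofReal (p.eval ((k : ℝ) + 1)) := by
    intro k
    have hint : IntegrableOn f (Metric.ball y ((k : ℝ) + 1)) :=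
      (hf.continuousOn.integrableOn_compact (isCompact_closedBall y _)).mono_set
        Metric.ball_subset_closedBall
    rw [← ofReal_integral_eq_lintegral_ofReal hint (Filter.Eventually.of_forall hf0)]
    exact ENNReal.ofReal_le_ofReal (hp _ (by positivity))
  -- On the shell k ≤ |x - y| < k + 1 the Gaussian is at most exp(-ak²), so the single term with k =
  -- ⌊|x - y|⌋ already dominates. Using whole balls instead of shells lets the growth bound apply
  -- directly.
  have hle : ∀ x, ENNReal.ofReal (f x * Real.exp (-(a * ‖x - y‖ ^ 2))) ≤
      ∑' k : ℕ, ENNReal.ofReal (Real.exp (-(a * k ^ 2))) *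
        (Metric.ball y ((k : ℝ) + 1)).indicator (fun x => ENNReal.ofReal (f x)) x := by
    intro x
    refine le_trans ?_ (ENNReal.le_tsum ⌊‖x - y‖⌋₊)
    have hx : x ∈ Metric.ball y ((⌊‖x - y‖⌋₊ : ℝ) + 1) := by
      rw [mem_ball_iff_norm]; exact Nat.lt_floor_add_one _
    rw [Set.indicator_of_mem hx, mul_comm, ENNReal.ofReal_mul (Real.exp_pos _).le]
    gcongr
    exact Nat.floor_le (norm_nonneg _)
  -- The polynomial is shifted because the k-th ball has radius k + 1.
  have hsum : Summable fun k : ℕ => (p.comp (Polynomial.X + 1)).eval (k : ℝ) * Real.exp (-(a * k)) :=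
    summable_polynomial_mul_exp _ ha
  have hp0 : ∀ k : ℕ, 0 ≤ p.eval ((k : ℝ) + 1) := fun k =>
    (integral_nonneg hf0).trans (hp _ (by positivity))
  calc ∫⁻ x, ENNReal.ofReal (f x * Real.exp (-(a * ‖x - y‖ ^ 2)))
      ≤ ∫⁻ x, ∑' k : ℕ, ENNReal.ofReal (Real.exp (-(a * k ^ 2))) *
        (Metric.ball y ((k : ℝ) + 1)).indicator (fun x => ENNReal.ofReal (f x)) x :=
        lintegral_mono hle
    _ = ∑' k : ℕ, ENNReal.ofReal (Real.exp (-(a * k ^ 2))) *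
        ∫⁻ x in Metric.ball y ((k : ℝ) + 1), ENNReal.ofReal (f x) := by
        have hm : Measurable fun x => ENNReal.ofReal (f x) := hf.measurable.ennreal_ofReal
        rw [lintegral_tsum fun k =>
          ((hm.indicator Metric.isOpen_ball.measurableSet).const_mul _).aemeasurable]
        congr 1; ext k
        rw [lintegral_const_mul _ (hm.indicator Metric.isOpen_ball.measurableSet),
          lintegral_indicator Metric.isOpen_ball.measurableSet]
    _ ≤ ∑' k : ℕ, ENNReal.ofReal
        ((p.comp (Polynomial.X + 1)).eval (k : ℝ) * Real.exp (-(a * k))) := by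
        refine ENNReal.tsum_le_tsum fun k => ?_
        simp only [Polynomial.eval_comp, Polynomial.eval_add, Polynomial.eval_X,
          Polynomial.eval_one]
        rw [mul_comm, ENNReal.ofReal_mul (hp0 k)]
        refine mul_le_mul' (hball k) (ENNReal.ofReal_le_ofReal (Real.exp_le_exp.2 ?_))
        -- For natural numbers k ≤ k², so the Gaussian factor may be weakened to a geometric one.
        have hk : (k : ℝ) ≤ (k : ℝ) ^ 2 := by exact_mod_cast Nat.le_self_pow two_ne_zero k
        nlinarith
    _ < ⊤ := by
        rw [← ENNReal.ofReal_tsum_of_nonneg _ hsum]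
        · exact ENNReal.ofReal_lt_top
        · intro k
          simp only [Polynomial.eval_comp, Polynomial.eval_add, Polynomial.eval_X,
            Polynomial.eval_one]
          exact mul_nonneg (hp0 k) (Real.exp_pos _).le

end Gaussian

/-! ### Smooth families of connections, viewed as functions on ℝ × ℝⁿ. -/

section Families

variable {𝕜 : Type*} [RCLike 𝕜] {n r : ℕ}

section SpaceTime

variable {F : Type*} [NormedAddCommGroup F] [NormedSpace ℝ F] {f : ℝ × Rn n → F}

theorem fderiv_slice (hf : ContDiff ℝ ∞ f) (s : ℝ) (x v : Rn n) :
    fderiv ℝ (fun y => f (s, y)) x v = fderiv ℝ f (s, x) (0, v) := by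
  have h : HasFDerivAt (fun y => f (s, y)) _ x :=
    (hf.differentiable (by simp) (s, x)).hasFDerivAt.comp x (hasFDerivAt_prodMk_right s x)
  rw [h.fderiv]
  simp

theorem hasDerivAt_slice (hf : ContDiff ℝ ∞ f) (s : ℝ) (x : Rn n) :
    HasDerivAt (fun σ => f (σ, x)) (fderiv ℝ f (s, x) (1, 0)) s := by
  have h := ((hf.differentiable (by simp) (s, x)).hasFDerivAt.comp s
    (hasFDerivAt_prodMk_left s x)).hasDerivAt
  simpa [Function.comp_def] using h

theorem contDiff_fderiv_apply {E : Type*} [NormedAddCommGroup E] [NormedSpace ℝ E] {g : E → F}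
    (hg : ContDiff ℝ ∞ g) (v : E) : ContDiff ℝ ∞ fun q => fderiv ℝ g q v :=
  (hg.fderiv_right (m := ∞) (by simp)).clm_apply contDiff_const

/-- Partial derivatives in the parameter and in space commute. -/
theorem hasDerivAt_fderiv_slice (hf : ContDiff ℝ ∞ f) (s : ℝ) (x v : Rn n) :
    HasDerivAt (fun σ => fderiv ℝ (fun y => f (σ, y)) x v)
      (fderiv ℝ (fun y => deriv (fun σ => f (σ, y)) s) x v) s := by
  have h1 : (fun y => deriv (fun σ => f (σ, y)) s) = fun y => fderiv ℝ f (s, y) (1, 0) := by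
    ext y; exact (hasDerivAt_slice hf s y).deriv
  have h2 := hasDerivAt_slice (contDiff_fderiv_apply hf ((0 : ℝ), v)) s x
  rw [h1, fderiv_slice (f := fun q => fderiv ℝ f q (1, 0)) (contDiff_fderiv_apply hf _) s x v,
    fderiv_fderiv_comm hf]
  simpa only [fderiv_slice hf] using h2

end SpaceTime

variable {conn : ℝ → Connection 𝕜 n r}

theorem curvature_contDiff_family
    (hc : ∀ i β α, ContDiff ℝ ∞ fun q : ℝ × Rn n => (conn q.1).coeff q.2 i β α)
    (i j : Fin n) (β α : Fin r) :
    ContDiff ℝ ∞ fun q : ℝ × Rn n => (conn q.1).curvature q.2 i j β α := by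
  simp only [Connection.curvature, pderiv, Matrix.sub_apply, Matrix.add_apply, Matrix.mul_apply,
    Matrix.of_apply]
  have h : ∀ i j, ContDiff ℝ ∞ fun q : ℝ × Rn n =>
      fderiv ℝ (fun y => (conn q.1).coeff y j β α) q.2 (EuclideanSpace.single i 1) := by
    intro i j
    have := contDiff_fderiv_apply (hc j β α) ((0 : ℝ), (EuclideanSpace.single i 1 : Rn n))
    simpa only [← fderiv_slice (hc j β α)] using this
  exact (((h i j).sub (h j i)).add (ContDiff.sum fun γ _ => (hc i β γ).mul (hc j γ α))).sub
    (ContDiff.sum fun γ _ => (hc j β γ).mul (hc i γ α))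

theorem velocity_entrySmooth
    (hc : ∀ i β α, ContDiff ℝ ∞ fun q : ℝ × Rn n => (conn q.1).coeff q.2 i β α)
    (s : ℝ) (i : Fin n) : EntrySmooth fun x => velocity conn s x i := by
  intro β α
  simp only [velocity, Matrix.of_apply]
  have : (fun x => deriv (fun σ => (conn σ).coeff x i β α) s) = fun x =>
      fderiv ℝ (fun q : ℝ × Rn n => (conn q.1).coeff q.2 i β α) (s, x) (1, 0) := by
    ext x; exact (hasDerivAt_slice (hc i β α) s x).deriv
  rw [this]
  exact (contDiff_fderiv_apply (hc i β α) _).comp (contDiff_const.prodMk contDiff_id)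

theorem hasDerivAt_curvature_family
    (hc : ∀ i β α, ContDiff ℝ ∞ fun q : ℝ × Rn n => (conn q.1).coeff q.2 i β α)
    (s : ℝ) (x : Rn n) (i j : Fin n) (β α : Fin r) :
    HasDerivAt (fun σ => (conn σ).curvature x i j β α) (curvatureVelocity conn s x i j β α) s :=
  ((hasDerivAt_slice (curvature_contDiff_family hc i j β α) s x).differentiableAt).hasDerivAt

/-- The variation of the curvature is the exterior covariant derivative of the variation of the
connection. -/
theorem curvatureVelocity_eq_covDeriv
    (hc : ∀ i β α, ContDiff ℝ ∞ fun q : ℝ × Rn n => (conn q.1).coeff q.2 i β α)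
    (s : ℝ) (x : Rn n) (i j : Fin n) :
    curvatureVelocity conn s x i j =
      (conn s).covDeriv i (fun y => velocity conn s y j) x
        - (conn s).covDeriv j (fun y => velocity conn s y i) x := by
  ext β α
  have hd : ∀ i β α, HasDerivAt (fun σ => (conn σ).coeff x i β α) (velocity conn s x i β α) s :=
    fun i β α => (hasDerivAt_slice (hc i β α) s x).differentiableAt.hasDerivAt
  have hp : ∀ i j, HasDerivAt (fun σ => pderiv i (fun y => (conn σ).coeff y j) x β α)
      (pderiv i (fun y => velocity conn s y j) x β α) s :=
    fun i j => hasDerivAt_fderiv_slice (hc j β α) s x _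
  have hm : ∀ i j, HasDerivAt (fun σ => ((conn σ).coeff x i * (conn σ).coeff x j) β α)
      ((velocity conn s x i * (conn s).coeff x j + (conn s).coeff x i * velocity conn s x j) β α)
      s := by
    intro i j
    simp only [Matrix.mul_apply, Matrix.add_apply, ← Finset.sum_add_distrib]
    exact HasDerivAt.fun_sum fun γ _ => (hd i β γ).mul (hd j γ α)
  have h := ((((hp i j).sub (hp j i)).add (hm i j)).sub (hm j i)).deriv
  refine (Eq.trans ?_ h).trans ?_
  · rfl
  -- The product rule on the quadratic terms of the curvature supplies exactly the commutators [Γᵢ,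
  -- Bⱼ] - [Γⱼ, Bᵢ].
  · simp only [Connection.covDeriv, Matrix.sub_apply, Matrix.add_apply]
    ring

theorem hasDerivAt_ip {A B : ℝ → Matrix (Fin r) (Fin r) 𝕜} {A' B' : Matrix (Fin r) (Fin r) 𝕜}
    {s : ℝ} (hA : ∀ β α, HasDerivAt (fun σ => A σ β α) (A' β α) s)
    (hB : ∀ β α, HasDerivAt (fun σ => B σ β α) (B' β α) s) :
    HasDerivAt (fun σ => ip (A σ) (B σ)) (ip A' (B s) + ip (A s) B') s := by
  simp only [ip_eq_sum, ← Finset.sum_add_distrib]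
  refine HasDerivAt.fun_sum fun β _ => HasDerivAt.fun_sum fun α _ => ?_
  have h := ((RCLike.reCLM (K := 𝕜)).hasFDerivAt.comp_hasDerivAt s ((hA β α).mul (hB β α).star))
  simpa [Function.comp_def] using h

end Families

/-! ### Pointwise inner products of forms. -/

section Tensors

variable {𝕜 : Type*} [RCLike 𝕜] {n r : ℕ}

/-- The inner product of two `End E`-valued two-tensors at a point. -/
def ipTwo (η ζ : Fin n → Fin n → Matrix (Fin r) (Fin r) 𝕜) : ℝ := ∑ i, ∑ j, ip (η i j) (ζ i j)

/-- The inner product of two `End E`-valued one-forms at a point. -/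
def ipOne (B C : Fin n → Matrix (Fin r) (Fin r) 𝕜) : ℝ := ∑ i, ip (B i) (C i)

theorem ipTwo_self (η : Fin n → Fin n → Matrix (Fin r) (Fin r) 𝕜) : ipTwo η η = normSqTwo η := by
  simp only [ipTwo, normSqTwo, ip_self]

theorem ipOne_self (B : Fin n → Matrix (Fin r) (Fin r) 𝕜) : ipOne B B = normSqOne B := by
  simp only [ipOne, normSqOne, ip_self]

theorem normSqTwo_nonneg (η : Fin n → Fin n → Matrix (Fin r) (Fin r) 𝕜) : 0 ≤ normSqTwo η :=
  Finset.sum_nonneg fun _ _ => Finset.sum_nonneg fun _ _ => matNormSq_nonneg _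

theorem normSqOne_nonneg (B : Fin n → Matrix (Fin r) (Fin r) 𝕜) : 0 ≤ normSqOne B :=
  Finset.sum_nonneg fun _ _ => matNormSq_nonneg _

theorem matNormSq_le_normSqOne (B : Fin n → Matrix (Fin r) (Fin r) 𝕜) (j : Fin n) :
    matNormSq (B j) ≤ normSqOne B :=
  Finset.single_le_sum (f := fun j => matNormSq (B j)) (fun _ _ => matNormSq_nonneg _)
    (Finset.mem_univ j)

theorem matNormSq_le_normSqTwo (η : Fin n → Fin n → Matrix (Fin r) (Fin r) 𝕜) (i j : Fin n) :
    matNormSq (η i j) ≤ normSqTwo η :=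
  (matNormSq_le_normSqOne (η i) j).trans
    (Finset.single_le_sum (f := fun i => ∑ j, matNormSq (η i j))
      (fun _ _ => Finset.sum_nonneg fun _ _ => matNormSq_nonneg _) (Finset.mem_univ i))

theorem norm_entry_sq_le_matNormSq (A : Matrix (Fin r) (Fin r) 𝕜) (β α : Fin r) :
    ‖A β α‖ ^ 2 ≤ matNormSq A :=
  (Finset.single_le_sum (f := fun α => ‖A β α‖ ^ 2) (fun _ _ => by positivity)
    (Finset.mem_univ α)).trans
    (Finset.single_le_sum (f := fun β => ∑ α, ‖A β α‖ ^ 2) (fun _ _ => by positivity)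
      (Finset.mem_univ β))

theorem two_mul_abs_ipTwo_le (η ζ : Fin n → Fin n → Matrix (Fin r) (Fin r) 𝕜) :
    2 * |ipTwo η ζ| ≤ normSqTwo η + normSqTwo ζ := by
  simp only [ipTwo, normSqTwo, ← Finset.sum_add_distrib]
  refine (mul_le_mul_of_nonneg_left (Finset.abs_sum_le_sum_abs _ _) two_pos.le).trans ?_
  rw [Finset.mul_sum]
  refine Finset.sum_le_sum fun i _ => ?_
  refine (mul_le_mul_of_nonneg_left (Finset.abs_sum_le_sum_abs _ _) two_pos.le).trans ?_
  rw [Finset.mul_sum]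
  exact Finset.sum_le_sum fun j _ => abs_ip_le _ _

theorem contDiff_ipTwo {η ζ : TwoForm 𝕜 n r} (hη : ∀ i j, EntrySmooth fun x => η x i j)
    (hζ : ∀ i j, EntrySmooth fun x => ζ x i j) : ContDiff ℝ ∞ fun x => ipTwo (η x) (ζ x) :=
  ContDiff.sum fun i _ => ContDiff.sum fun j _ => (hη i j).ip (hζ i j)

theorem contDiff_ipOne {B C : OneForm 𝕜 n r} (hB : ∀ i, EntrySmooth fun x => B x i)
    (hC : ∀ i, EntrySmooth fun x => C x i) : ContDiff ℝ ∞ fun x => ipOne (B x) (C x) :=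
  ContDiff.sum fun i _ => (hB i).ip (hC i)

theorem contDiff_normSqTwo {η : TwoForm 𝕜 n r} (hη : ∀ i j, EntrySmooth fun x => η x i j) :
    ContDiff ℝ ∞ fun x => normSqTwo (η x) := by
  simpa only [ipTwo_self] using contDiff_ipTwo hη hη

theorem contDiff_normSqOne {B : OneForm 𝕜 n r} (hB : ∀ i, EntrySmooth fun x => B x i) :
    ContDiff ℝ ∞ fun x => normSqOne (B x) := by
  simpa only [ipOne_self] using contDiff_ipOne hB hB

end Tensors

/-! ### Derivatives and bounds of the Gaussian kernel. -/

section Kernel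

variable {n : ℕ}

theorem kernelG_contDiff (x₀ : Rn n) (t₀ : ℝ) : ContDiff ℝ ∞ (kernelG x₀ t₀) := by
  unfold kernelG
  have h : ContDiff ℝ ∞ fun x : Rn n => ‖x - x₀‖ ^ 2 :=
    (contDiff_id.sub contDiff_const).norm_sq ℝ
  exact contDiff_const.mul (Real.contDiff_exp.comp (h.neg.div_const _))

theorem kernelG_pos (x₀ : Rn n) {t₀ : ℝ} (ht : 0 < t₀) (x : Rn n) : 0 < kernelG x₀ t₀ x := by
  unfold kernelG; positivity

/-- This logarithmic gradient is the source of the interior-product term in the soliton operator. -/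
theorem fderiv_kernelG (x₀ : Rn n) (t₀ : ℝ) (x : Rn n) (i : Fin n) :
    fderiv ℝ (kernelG x₀ t₀) x (EuclideanSpace.single i 1) =
      -(1 / (2 * t₀) * (x - x₀) i) * kernelG x₀ t₀ x := by
  have h1 : HasFDerivAt (fun x : Rn n => ‖x - x₀‖ ^ 2) _ x :=
    ((hasFDerivAt_id x).sub_const x₀).norm_sq
  have h2 := ((h1.fun_neg.mul_const (4 * t₀)⁻¹).exp).const_mul ((4 * Real.pi * t₀) ^ (-(n : ℝ) / 2))
  have h3 : kernelG x₀ t₀ = fun x => (4 * Real.pi * t₀) ^ (-(n : ℝ) / 2) *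
      Real.exp (-‖x - x₀‖ ^ 2 * (4 * t₀)⁻¹) := by
    ext x; rw [kernelG, div_eq_mul_inv (-‖x - x₀‖ ^ 2)]
  rw [h3, h2.fderiv]
  simp [EuclideanSpace.inner_single_right]
  ring

theorem fderiv_mul_kernelG {g : Rn n → ℝ} {x : Rn n} (hg : DifferentiableAt ℝ g x) (x₀ : Rn n)
    (t₀ : ℝ) (i : Fin n) :
    fderiv ℝ (fun y => g y * kernelG x₀ t₀ y) x (EuclideanSpace.single i 1) =
      (fderiv ℝ g x (EuclideanSpace.single i 1) - 1 / (2 * t₀) * (x - x₀) i * g x)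
        * kernelG x₀ t₀ x := by
  rw [fderiv_fun_mul hg ((kernelG_contDiff x₀ t₀).differentiable (by simp) x)]
  simp only [_root_.add_apply, _root_.smul_apply, fderiv_kernelG, smul_eq_mul]
  ring

/-- The logarithmic rate of change of the kernel when the centre `z` moves with velocity `w` and
the scale `t` with velocity `τ`. -/
def kernelRate (z w : Rn n) (t τ : ℝ) (x : Rn n) : ℝ :=
  -(n : ℝ) / 2 * τ / t + inner ℝ (x - z) w / (2 * t) + ‖x - z‖ ^ 2 * τ / (4 * t ^ 2)

theorem continuous_kernelRate (z w : Rn n) (t τ : ℝ) : Continuous (kernelRate z w t τ) := by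
  unfold kernelRate
  fun_prop

theorem hasDerivAt_kernelG {z : ℝ → Rn n} {t : ℝ → ℝ} {w : Rn n} {τ s : ℝ}
    (hz : HasDerivAt z w s) (ht : HasDerivAt t τ s) (hts : 0 < t s) (x : Rn n) :
    HasDerivAt (fun σ => kernelG (z σ) (t σ) x)
      (kernelG (z s) (t s) x * kernelRate (z s) w (t s) τ x) s := by
  have h1 := (hz.const_sub x).norm_sq
  have h2 := (h1.fun_neg.fun_div (ht.const_mul 4) (by positivity)).exp
  have hpos : 0 < 4 * Real.pi * t s := by positivity
  have h3 := (ht.const_mul (4 * Real.pi)).rpow_const (p := -(n : ℝ) / 2) (Or.inl hpos.ne')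
  have h := h3.mul h2
  refine h.congr_deriv ?_
  simp only [kernelG, kernelRate]
  rw [Real.rpow_sub_one hpos.ne', inner_neg_right]
  field_simp
  ring

/-- The rate grows at most quadratically in the distance to the centre; this is why the Gaussian
comparisons carry the weight 1 + |x - z|². A lower bound on the scale is needed because its inverse
powers occur. -/
theorem abs_kernelRate_le {z w : Rn n} {t τ m K : ℝ} (hm : 0 < m) (hmt : m ≤ t) (hw : ‖w‖ ≤ K)
    (hτ : |τ| ≤ K) (x : Rn n) :
    |kernelRate z w t τ x| ≤ (n * K / m + K / m + K / m ^ 2) * (1 + ‖x - z‖ ^ 2) := by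
  have ht : 0 < t := hm.trans_le hmt
  have hK : 0 ≤ K := (norm_nonneg _).trans hw
  set u := ‖x - z‖
  have hu : 0 ≤ u := norm_nonneg _
  have h1 : |-(n : ℝ) / 2 * τ / t| ≤ n * K / m := by
    rw [abs_div, abs_mul, abs_div, abs_neg, Nat.abs_cast, abs_of_pos ht, abs_two]
    have : (n : ℝ) / 2 ≤ n := half_le_self (Nat.cast_nonneg n)
    gcongr
  have h2 : |inner ℝ (x - z) w / (2 * t)| ≤ K / m * (1 + u ^ 2) := by
    rw [abs_div, abs_of_pos (show (0 : ℝ) < 2 * t by positivity)]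
    have h : |inner ℝ (x - z) w| ≤ (1 + u ^ 2) * K :=
      (abs_real_inner_le_norm _ _).trans (by
        refine mul_le_mul ?_ hw (norm_nonneg _) (by positivity)
        nlinarith [sq_nonneg (u - 1)])
    rw [div_mul_eq_mul_div, mul_comm K]
    exact div_le_div₀ (by positivity) h hm (by linarith)
  have h3 : |u ^ 2 * τ / (4 * t ^ 2)| ≤ K / m ^ 2 * (1 + u ^ 2) := by
    rw [abs_div, abs_mul, abs_of_nonneg (sq_nonneg u),
      abs_of_pos (show (0 : ℝ) < 4 * t ^ 2 by positivity), div_mul_eq_mul_div, mul_comm K]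
    have : m ^ 2 ≤ t ^ 2 := by gcongr
    refine div_le_div₀ (by positivity) ?_ (by positivity) (by nlinarith [sq_nonneg t])
    exact mul_le_mul (by linarith) hτ (abs_nonneg _) (by positivity)
  have h4 : n * K / m ≤ n * K / m * (1 + u ^ 2) :=
    le_mul_of_one_le_right (by positivity) (by nlinarith [sq_nonneg u])
  calc _ ≤ _ := abs_add_three _ _ _
    _ ≤ n * K / m * (1 + u ^ 2) + K / m * (1 + u ^ 2) + K / m ^ 2 * (1 + u ^ 2) := by
      gcongr; exact h1.trans h4
    _ = _ := by ring

/-- Nearby kernels, with quadratic weights, are dominated by a fixed wider Gaussian. -/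
theorem exists_kernelG_bound (x₀ : Rn n) {m T₁ T : ℝ} (hm : 0 < m) (hmT : m ≤ T₁) (hT : T₁ < T)
    (R : ℝ) : ∃ C, 0 ≤ C ∧ ∀ z t x, ‖z - x₀‖ ≤ R → m ≤ t → t ≤ T₁ →
      (1 + ‖x - z‖ ^ 2) * kernelG z t x ≤ C * Real.exp (-‖x - x₀‖ ^ 2 / (4 * T)) := by
  obtain ⟨C, hC0, hC⟩ := exists_gaussian_bound (hm.trans_le hmT) hT (R := R) x₀
  refine ⟨(4 * Real.pi * m) ^ (-(n : ℝ) / 2) * C, by positivity, fun z t x hz hmt htT => ?_⟩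
  have ht : 0 < t := hm.trans_le hmt
  have h1 : (4 * Real.pi * t) ^ (-(n : ℝ) / 2) ≤ (4 * Real.pi * m) ^ (-(n : ℝ) / 2) :=
    Real.rpow_le_rpow_of_nonpos (by positivity) (by gcongr)
      (by have : (0 : ℝ) ≤ n := Nat.cast_nonneg n
          linarith)
  calc (1 + ‖x - z‖ ^ 2) * kernelG z t x
      = (4 * Real.pi * t) ^ (-(n : ℝ) / 2) *
        ((1 + ‖x - z‖ ^ 2) * Real.exp (-‖x - z‖ ^ 2 / (4 * t))) := by rw [kernelG]; ring
    _ ≤ (4 * Real.pi * m) ^ (-(n : ℝ) / 2) * (C * Real.exp (-‖x - x₀‖ ^ 2 / (4 * T))) :=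
        mul_le_mul h1 (hC z t x hz ht htT) (by positivity) (by positivity)
    _ = _ := by ring

end Kernel

/-! ### Differentiating the weighted energy under the integral sign. -/

section FirstVariation

variable {𝕜 : Type*} [RCLike 𝕜] {n r : ℕ}

theorem Connection.continuous_normSqTwo_curvature (D : Connection 𝕜 n r) :
    Continuous fun x => normSqTwo (D.curvature x) :=
  (contDiff_normSqTwo D.curvature_entrySmooth).continuous

/-- The centre y of the growth condition is immaterial: a Gaussian about x₀ of scale T is dominated
by one about y of scale 2T. -/
theorem PolynomialEnergyGrowth.integrable_gaussian {D : Connection 𝕜 n r} {y : Rn n}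
    (h : PolynomialEnergyGrowth D y) (x₀ : Rn n) {T : ℝ} (hT : 0 < T) :
    Integrable fun x => normSqTwo (D.curvature x) * Real.exp (-‖x - x₀‖ ^ 2 / (4 * T)) := by
  obtain ⟨p, hp⟩ := h
  obtain ⟨C, hC0, hC⟩ := exists_gaussian_bound hT (show T < 2 * T by linarith)
    (R := ‖x₀ - y‖) y
  have hcont := D.continuous_normSqTwo_curvature
  have hint := integrable_mul_gaussian_of_growth hcont (fun x => normSqTwo_nonneg _) hp
    (a := 1 / (4 * (2 * T))) (by positivity)
  refine (hint.const_mul C).mono' (Continuous.aestronglyMeasurable (by fun_prop))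
    (Filter.Eventually.of_forall fun x => ?_)
  have h0 := normSqTwo_nonneg (D.curvature x)
  rw [Real.norm_of_nonneg (by positivity)]
  have h1 : Real.exp (-‖x - x₀‖ ^ 2 / (4 * T)) ≤
      C * Real.exp (-‖x - y‖ ^ 2 / (4 * (2 * T))) := by
    refine le_trans ?_ (hC x₀ T x le_rfl hT le_rfl)
    exact le_mul_of_one_le_left (Real.exp_pos _).le (by nlinarith [sq_nonneg ‖x - x₀‖])
  have h2 : -(1 / (4 * (2 * T)) * ‖x - y‖ ^ 2) = -‖x - y‖ ^ 2 / (4 * (2 * T)) := by ring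
  rw [h2]
  calc _ ≤ _ := mul_le_mul_of_nonneg_left h1 h0
    _ = _ := by ring

/-- The gap between t₀ and T absorbs the quadratic weight. All integrability statements against the
fixed kernel reduce to this one. -/
theorem integrable_mul_kernelG_of_bound {g b : Rn n → ℝ} (hg : Continuous g) (x₀ : Rn n) {t₀ T : ℝ}
    (ht₀ : 0 < t₀) (hT : t₀ < T)
    (hb : Integrable fun x => b x * Real.exp (-‖x - x₀‖ ^ 2 / (4 * T)))
    (hgb : ∀ x, |g x| ≤ (1 + ‖x - x₀‖ ^ 2) * b x) :
    Integrable fun x => g x * kernelG x₀ t₀ x := by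
  obtain ⟨C, hC0, hC⟩ := exists_kernelG_bound x₀ ht₀ le_rfl hT 0
  refine (hb.const_mul C).mono'
    (hg.mul (kernelG_contDiff x₀ t₀).continuous).aestronglyMeasurable
    (Filter.Eventually.of_forall fun x => ?_)
  have h1 := hC x₀ t₀ x (by simp) le_rfl le_rfl
  have hb0 : 0 ≤ b x := by
    have := (abs_nonneg _).trans (hgb x)
    exact nonneg_of_mul_nonneg_right this (by positivity)
  rw [norm_mul, Real.norm_eq_abs, Real.norm_of_nonneg (kernelG_pos x₀ ht₀ x).le]
  calc |g x| * kernelG x₀ t₀ x ≤ (1 + ‖x - x₀‖ ^ 2) * b x * kernelG x₀ t₀ x :=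
        mul_le_mul_of_nonneg_right (hgb x) (kernelG_pos x₀ ht₀ x).le
    _ = b x * ((1 + ‖x - x₀‖ ^ 2) * kernelG x₀ t₀ x) := by ring
    _ ≤ b x * (C * Real.exp (-‖x - x₀‖ ^ 2 / (4 * T))) := mul_le_mul_of_nonneg_left h1 hb0
    _ = _ := by ring

theorem hasDerivAt_normSqTwo_curvature {conn : ℝ → Connection 𝕜 n r}
    (hc : ∀ i β α, ContDiff ℝ ∞ fun q : ℝ × Rn n => (conn q.1).coeff q.2 i β α)
    (s : ℝ) (x : Rn n) :
    HasDerivAt (fun σ => normSqTwo ((conn σ).curvature x))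
      (2 * ipTwo ((conn s).curvature x) (curvatureVelocity conn s x)) s := by
  simp only [← ipTwo_self, ipTwo, Finset.mul_sum]
  refine HasDerivAt.fun_sum fun i _ => HasDerivAt.fun_sum fun j _ => ?_
  refine (hasDerivAt_ip (hasDerivAt_curvature_family hc s x i j)
    (hasDerivAt_curvature_family hc s x i j)).congr_deriv ?_
  rw [ip_comm (curvatureVelocity conn s x i j)]
  ring

theorem curvatureVelocity_entrySmooth {conn : ℝ → Connection 𝕜 n r}
    (hc : ∀ i β α, ContDiff ℝ ∞ fun q : ℝ × Rn n => (conn q.1).coeff q.2 i β α)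
    (s : ℝ) (i j : Fin n) : EntrySmooth fun x => curvatureVelocity conn s x i j := by
  simp only [curvatureVelocity_eq_covDeriv hc]
  exact ((conn s).covDeriv_entrySmooth (velocity_entrySmooth hc s j) i).sub
    ((conn s).covDeriv_entrySmooth (velocity_entrySmooth hc s i) j)

/-- A bound on the velocity of the curvature bounds the curvature along the family. -/
theorem normSqTwo_curvature_le {conn : ℝ → Connection 𝕜 n r}
    (hc : ∀ i β α, ContDiff ℝ ∞ fun q : ℝ × Rn n => (conn q.1).coeff q.2 i β α)
    {ε H : ℝ} {x : Rn n} (hH : ∀ s, |s| < ε → normSqTwo (curvatureVelocity conn s x) ≤ H)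
    {s : ℝ} (hs : |s| < ε) (hs1 : |s| ≤ 1) :
    normSqTwo ((conn s).curvature x) ≤
      2 * normSqTwo ((conn 0).curvature x) + (n * n * r * r : ℕ) * (2 * H) := by
  have hε : 0 < ε := (abs_nonneg s).trans_lt hs
  have hH0 : 0 ≤ H := (normSqTwo_nonneg _).trans (hH s hs)
  have hentry : ∀ i j β α, ‖(conn s).curvature x i j β α‖ ^ 2 ≤
      2 * ‖(conn 0).curvature x i j β α‖ ^ 2 + 2 * H := by
    intro i j β α
    have hb : ∀ σ ∈ Metric.ball (0 : ℝ) ε, ‖curvatureVelocity conn σ x i j β α‖ ≤ √H := by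
      intro σ hσ
      rw [mem_ball_zero_iff, Real.norm_eq_abs] at hσ
      exact Real.le_sqrt_of_sq_le ((norm_entry_sq_le_matNormSq _ β α).trans
        ((matNormSq_le_normSqTwo _ i j).trans (hH σ hσ)))
    -- Mean value inequality for each entry; since |s| ≤ 1 the factor |s| can be dropped. Then (p +
    -- q)² ≤ 2p² + 2q², and the final constant counts the n²r² entries.
    have hmv := (convex_ball (0 : ℝ) ε).norm_image_sub_le_of_norm_hasDerivWithin_le
      (fun σ _ => (hasDerivAt_curvature_family hc σ x i j β α).hasDerivWithinAt) hb
      (Metric.mem_ball_self hε) (show s ∈ Metric.ball (0 : ℝ) ε by simpa using hs)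
    rw [sub_zero, Real.norm_eq_abs] at hmv
    have h1 : ‖(conn s).curvature x i j β α - (conn 0).curvature x i j β α‖ ≤ √H :=
      hmv.trans (mul_le_of_le_one_right (Real.sqrt_nonneg _) hs1)
    have h2 : ‖(conn s).curvature x i j β α‖ ≤ ‖(conn 0).curvature x i j β α‖ + √H :=
      (norm_le_norm_add_norm_sub' _ _).trans (by gcongr)
    have h3 := Real.sq_sqrt hH0
    calc _ ≤ (‖(conn 0).curvature x i j β α‖ + √H) ^ 2 := by gcongr
      _ ≤ _ := by nlinarith [sq_nonneg (‖(conn 0).curvature x i j β α‖ - √H)]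
  calc normSqTwo ((conn s).curvature x)
      ≤ ∑ i : Fin n, ∑ j : Fin n, ∑ β : Fin r, ∑ α : Fin r,
        (2 * ‖(conn 0).curvature x i j β α‖ ^ 2 + 2 * H) :=
        Finset.sum_le_sum fun i _ => Finset.sum_le_sum fun j _ => Finset.sum_le_sum fun β _ =>
          Finset.sum_le_sum fun α _ => hentry i j β α
    _ = _ := by
        simp only [normSqTwo, matNormSq, Finset.sum_add_distrib, Finset.mul_sum,
          Finset.sum_const, Finset.card_univ, Fintype.card_fin, nsmul_eq_mul]
        push_cast
        ring

/-- Differentiation under the integral sign along a variation. -/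
theorem Variation.hasDerivAt_integral {D : Connection 𝕜 n r} {x₀ y : Rn n} {t₀ : ℝ} (ht₀ : 0 < t₀)
    (hgrowth : PolynomialEnergyGrowth D y) (v : Variation D x₀ t₀) :
    HasDerivAt (fun s => ∫ x, normSqTwo ((v.conn s).curvature x) *
        kernelG (v.point s) (v.time s) x)
      (∫ x, (2 * ipTwo (D.curvature x) (curvatureVelocity v.conn 0 x) * kernelG x₀ t₀ x +
        normSqTwo (D.curvature x) *
          (kernelG x₀ t₀ x * kernelRate x₀ (deriv v.point 0) t₀ (deriv v.time 0) x))) 0 := by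
  obtain ⟨ε, T, h, hε, hT, hint, hbd⟩ := v.admissible
  have hc := v.conn_smooth
  -- Nearby scales stay below the midpoint `T₁`, which leaves a margin up to `T` for the polynomial
  -- weight.
  set T₁ := (t₀ + T) / 2 with hT₁
  obtain ⟨C, hC0, hC⟩ := exists_kernelG_bound x₀ (m := t₀ / 2) (T₁ := T₁) (T := T) (by linarith)
    (by linarith) (by linarith) 1
  -- The summand 1 makes the velocity bounds strict at s = 0, so by continuity they persist nearby.
  set K := ‖deriv v.point 0‖ + |deriv v.time 0| + 1 with hK
  set L := n * K / (t₀ / 2) + K / (t₀ / 2) + K / (t₀ / 2) ^ 2 with hL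
  have hK0 : 0 ≤ K := by positivity
  have hL0 : 0 ≤ L := by positivity
  have hpd : Continuous (deriv v.point) := v.point_smooth.continuous_deriv (by simp)
  have htd : Continuous (deriv v.time) := v.time_smooth.continuous_deriv (by simp)
  have hpt : ∀ s, HasDerivAt v.point (deriv v.point s) s :=
    fun s => (v.point_smooth.differentiable (by simp) s).hasDerivAt
  have htt : ∀ s, HasDerivAt v.time (deriv v.time s) s :=
    fun s => (v.time_smooth.differentiable (by simp) s).hasDerivAt
  have hnear : ∀ᶠ s in nhds (0 : ℝ), |s| < ε ∧ |s| < 1 ∧ ‖v.point s - x₀‖ < 1 ∧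
      t₀ / 2 < v.time s ∧ v.time s < T₁ ∧ ‖deriv v.point s‖ < K ∧ |deriv v.time s| < K := by
    have e : ∀ {f : ℝ → ℝ} {c : ℝ}, Continuous f → f 0 < c → ∀ᶠ s in nhds (0 : ℝ), f s < c :=
      fun hf h0 => hf.continuousAt.eventually_lt_const h0
    refine (e continuous_abs (by simpa)).and <| (e continuous_abs (by simp)).and <|
      (e (v.point_smooth.continuous.sub continuous_const).norm (by simp [v.point_zero])).and <|
      (v.time_smooth.continuous.continuousAt.eventually_const_lt ?_).and <|
      (e v.time_smooth.continuous ?_).and <| (e hpd.norm ?_).and (e htd.abs ?_)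
    · rw [v.time_zero]; linarith
    · rw [v.time_zero]; linarith
    · rw [hK]; linarith [abs_nonneg (deriv v.time 0)]
    · rw [hK]; linarith [norm_nonneg (deriv v.point 0)]
  set S := {s : ℝ | |s| < ε ∧ |s| < 1 ∧ ‖v.point s - x₀‖ < 1 ∧
      t₀ / 2 < v.time s ∧ v.time s < T₁ ∧ ‖deriv v.point s‖ < K ∧ |deriv v.time s| < K}
  set N : ℝ := ((n * n * r * r : ℕ) : ℝ) with hN
  have hN0 : 0 ≤ N := Nat.cast_nonneg _
  set E : Rn n → ℝ := fun x => Real.exp (-‖x - x₀‖ ^ 2 / (4 * T))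
  have hfE : Integrable fun x => normSqTwo (D.curvature x) * E x :=
    hgrowth.integrable_gaussian x₀ (ht₀.trans hT)
  have hcontF : ∀ s, Continuous fun x => normSqTwo ((v.conn s).curvature x) *
      kernelG (v.point s) (v.time s) x := fun s =>
    (v.conn s).continuous_normSqTwo_curvature.mul (kernelG_contDiff _ _).continuous
  have hkey := hasDerivAt_integral_of_dominated_loc_of_deriv_le (μ := volume) (s := S) (x₀ := 0)
    (F := fun s x => normSqTwo ((v.conn s).curvature x) * kernelG (v.point s) (v.time s) x)
    (F' := fun s x => 2 * ipTwo ((v.conn s).curvature x) (curvatureVelocity v.conn s x) *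
        kernelG (v.point s) (v.time s) x + normSqTwo ((v.conn s).curvature x) *
          (kernelG (v.point s) (v.time s) x *
            kernelRate (v.point s) (deriv v.point s) (v.time s) (deriv v.time s) x))
    -- The derivative is at most (f(1 + L) + h)·C·E, where f is the energy density at time s;
    -- inserting f ≤ 2|F|² + 2Nh from `normSqTwo_curvature_le` gives these coefficients.
    (bound := fun x => C * (2 * (1 + L)) * (normSqTwo (D.curvature x) * E x) +
      C * (2 * N * (1 + L) + 1) * (h x * E x))
    hnear (Filter.Eventually.of_forall fun s => (hcontF s).aestronglyMeasurable) ?_ ?_ ?_ ?_ ?_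
  · have := hkey.2
    simpa only [v.conn_zero, v.point_zero, v.time_zero] using this
  · simp only [v.conn_zero, v.point_zero, v.time_zero]
    refine integrable_mul_kernelG_of_bound D.continuous_normSqTwo_curvature x₀ ht₀ hT hfE
      fun x => ?_
    rw [abs_of_nonneg (normSqTwo_nonneg _)]
    exact le_mul_of_one_le_left (normSqTwo_nonneg _) (by nlinarith [sq_nonneg ‖x - x₀‖])
  · have h1 : Continuous fun x => ipTwo ((v.conn 0).curvature x) (curvatureVelocity v.conn 0 x) :=
      (contDiff_ipTwo (v.conn 0).curvature_entrySmooth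
        (curvatureVelocity_entrySmooth hc 0)).continuous
    have h2 := (v.conn 0).continuous_normSqTwo_curvature
    have h3 := (kernelG_contDiff (v.point 0) (v.time 0)).continuous
    have h4 := continuous_kernelRate (v.point 0) (deriv v.point 0) (v.time 0) (deriv v.time 0)
    exact (((h1.const_mul 2).mul h3).add (h2.mul (h3.mul h4))).aestronglyMeasurable
  · refine Filter.Eventually.of_forall fun x s hs => ?_
    obtain ⟨hs1, hs2, hs3, hs4, hs5, hs6, hs7⟩ := hs
    have hFs := normSqTwo_curvature_le hc (fun σ hσ => (hbd σ hσ x).2) hs1 hs2.le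
    rw [v.conn_zero, ← hN] at hFs
    have hG := hC (v.point s) (v.time s) x hs3.le hs4.le hs5.le
    have hrate := abs_kernelRate_le (show 0 < t₀ / 2 by linarith) hs4.le hs6.le hs7.le x
      (z := v.point s)
    rw [← hL] at hrate
    have hip := two_mul_abs_ipTwo_le ((v.conn s).curvature x) (curvatureVelocity v.conn s x)
    have hvel := (hbd s hs1 x).2
    have hGpos := kernelG_pos (v.point s) (v.time_pos s) x
    have hEpos : 0 < E x := Real.exp_pos _
    set G := kernelG (v.point s) (v.time s) x
    set u2 := ‖x - v.point s‖ ^ 2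
    have hu2 : 0 ≤ u2 := sq_nonneg _
    set f := normSqTwo ((v.conn s).curvature x)
    have hf0 : 0 ≤ f := normSqTwo_nonneg _
    have hh0 : 0 ≤ h x := (normSqTwo_nonneg _).trans hvel
    have hGE : G ≤ C * E x := (le_mul_of_one_le_left hGpos.le (by linarith)).trans hG
    refine (norm_add_le _ _).trans ?_
    rw [norm_mul, norm_mul, norm_mul, norm_mul, Real.norm_of_nonneg hGpos.le,
      Real.norm_of_nonneg hf0, Real.norm_eq_abs, Real.norm_eq_abs, Real.norm_eq_abs, abs_two]
    have h1 : 2 * |ipTwo ((v.conn s).curvature x) (curvatureVelocity v.conn s x)| * G ≤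
        (f + h x) * (C * E x) :=
      mul_le_mul (hip.trans (by linarith)) hGE hGpos.le (by positivity)
    have h2 : G * |kernelRate (v.point s) (deriv v.point s) (v.time s) (deriv v.time s) x| ≤
        L * (C * E x) := by
      calc _ ≤ G * (L * (1 + u2)) := mul_le_mul_of_nonneg_left hrate hGpos.le
        _ = L * ((1 + u2) * G) := by ring
        _ ≤ _ := mul_le_mul_of_nonneg_left hG hL0
    calc _ ≤ (f + h x) * (C * E x) + f * (L * (C * E x)) :=
          add_le_add h1 (mul_le_mul_of_nonneg_left h2 hf0)
      _ = (f * (1 + L) + h x) * (C * E x) := by ring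
      _ ≤ ((2 * normSqTwo (D.curvature x) + N * (2 * h x)) * (1 + L) + h x) * (C * E x) := by
          gcongr
      _ = _ := by ring
  · exact (hfE.const_mul _).add (hint.const_mul _)
  · refine Filter.Eventually.of_forall fun x s hs => ?_
    exact ((hasDerivAt_normSqTwo_curvature hc s x).mul
      (hasDerivAt_kernelG (hpt s) (htt s) (v.time_pos s) x))

end FirstVariation

/-! ### Integration by parts and the stress-energy identity. -/

section Identities

variable {𝕜 : Type*} [RCLike 𝕜] {n r : ℕ}

/-- Against an antisymmetric tensor both halves of an antisymmetrisation contribute equally. Thus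
⟨F, ∂ₛF⟩ becomes 2⟨F, ∇B⟩. -/
theorem ipTwo_sub_swap {η : Fin n → Fin n → Matrix (Fin r) (Fin r) 𝕜}
    (hη : ∀ i j, η i j = -η j i) (C : Fin n → Fin n → Matrix (Fin r) (Fin r) 𝕜) :
    ipTwo η (fun i j => C i j - C j i) = 2 * ipTwo η C := by
  have h : ∑ i, ∑ j, ip (η i j) (C j i) = -ipTwo η C := by
    rw [Finset.sum_comm, ipTwo]
    simp only [← Finset.sum_neg_distrib]
    refine Finset.sum_congr rfl fun i _ => Finset.sum_congr rfl fun j _ => ?_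
    rw [hη j i]
    simp
  have : ipTwo η (fun i j => C i j - C j i) = ipTwo η C - ∑ i, ∑ j, ip (η i j) (C j i) := by
    simp only [ipTwo, map_sub, Finset.sum_sub_distrib]
  rw [this, h]
  ring

namespace Connection

variable (D : Connection 𝕜 n r)

theorem covDeriv_smul {φ : Rn n → ℝ} {A : Rn n → Matrix (Fin r) (Fin r) 𝕜} {x : Rn n}
    (hφ : DifferentiableAt ℝ φ x) (hA : EntrySmooth A) (i : Fin n) :
    D.covDeriv i (fun y => φ y • A y) x =
      fderiv ℝ φ x (EuclideanSpace.single i 1) • A x + φ x • D.covDeriv i A x := by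
  have h : pderiv i (fun y => φ y • A y) x =
      fderiv ℝ φ x (EuclideanSpace.single i 1) • A x + φ x • pderiv i A x := by
    ext β α
    simp only [pderiv, Matrix.of_apply, Matrix.smul_apply, Matrix.add_apply]
    rw [fderiv_fun_smul hφ (hA.differentiableAt β α x)]
    simp [add_comm]
  simp only [covDeriv, h, Matrix.mul_smul, Matrix.smul_mul]
  module

theorem covDeriv_sum {ι : Type*} {t : Finset ι} {C : ι → Rn n → Matrix (Fin r) (Fin r) 𝕜}
    (hC : ∀ k ∈ t, EntrySmooth (C k)) (i : Fin n) (x : Rn n) :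
    D.covDeriv i (fun y => ∑ k ∈ t, C k y) x = ∑ k ∈ t, D.covDeriv i (C k) x := by
  have h : pderiv i (fun y => ∑ k ∈ t, C k y) x = ∑ k ∈ t, pderiv i (C k) x := by
    ext β α
    simp only [pderiv, Matrix.of_apply, Matrix.sum_apply]
    rw [fderiv_fun_sum fun k hk => (hC k hk).differentiableAt β α x]
    simp
  simp only [covDeriv, h, Finset.sum_add_distrib, Finset.sum_sub_distrib, Finset.mul_sum,
    Finset.sum_mul]

/-- The gradient of the energy density, by the second Bianchi identity. -/
theorem fderiv_normSqTwo_curvature (x : Rn n) (k : Fin n) :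
    fderiv ℝ (fun y => normSqTwo (D.curvature y)) x (EuclideanSpace.single k 1) =
      4 * ipTwo (D.curvature x) fun i j => D.covDeriv i (fun y => D.curvature y k j) x := by
  have hF := D.curvature_entrySmooth
  have hd : ∀ i j, DifferentiableAt ℝ (fun y => ip (D.curvature y i j) (D.curvature y i j)) x :=
    fun i j => ((hF i j).ip (hF i j)).differentiable (by simp) x
  have h1 : fderiv ℝ (fun y => normSqTwo (D.curvature y)) x (EuclideanSpace.single k 1) =
      2 * ipTwo (D.curvature x) fun i j => D.covDeriv k (fun y => D.curvature y i j) x := by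
    simp only [← ipTwo_self, ipTwo]
    rw [fderiv_fun_sum fun i _ => DifferentiableAt.fun_sum fun j _ => hd i j, _root_.sum_apply,
      Finset.mul_sum]
    refine Finset.sum_congr rfl fun i _ => ?_
    rw [fderiv_fun_sum fun j _ => hd i j, _root_.sum_apply, Finset.mul_sum]
    refine Finset.sum_congr rfl fun j _ => ?_
    rw [D.fderiv_ip_eq_covDeriv (hF i j) (hF i j), ip_comm (D.covDeriv _ _ _)]
    ring
  -- Bianchi writes ∇ₖFᵢⱼ as an antisymmetrisation in i and j. This yields a second factor 2 through
  -- `ipTwo_sub_swap`, hence the 4.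
  have h2 : ∀ i j, D.covDeriv k (fun y => D.curvature y i j) x =
      D.covDeriv i (fun y => D.curvature y k j) x
        - D.covDeriv j (fun y => D.curvature y k i) x := by
    intro i j
    have hb := D.bianchi k i j x
    have ha : D.covDeriv i (fun y => D.curvature y j k) x =
        -D.covDeriv i (fun y => D.curvature y k j) x := by
      rw [← D.covDeriv_neg]
      simp only [← D.curvature_antisymm]
    rw [ha] at hb
    rw [← sub_eq_zero, ← hb]
    abel
  rw [h1]
  simp only [h2]
  rw [ipTwo_sub_swap (D.curvature_antisymm x)
    fun i j => D.covDeriv i (fun y => D.curvature y k j) x]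
  ring

/-- The pairing is arranged as a sum over the divergence index i, so that it can be compared term by
term with a divergence. -/
theorem ipOne_solitonOperator (x₀ : Rn n) (t₀ : ℝ) (x : Rn n)
    (C : Fin n → Matrix (Fin r) (Fin r) 𝕜) :
    ipOne (solitonOperator x₀ t₀ D x) C =
      ∑ i, (1 / (2 * t₀) * (x - x₀) i * ∑ j, ip (D.curvature x i j) (C j)
        - ∑ j, ip (D.covDeriv i (fun y => D.curvature y i j) x) (C j)) := by
  simp only [ipOne, solitonOperator, adjoint, hook, map_add, map_neg, map_sum, map_smul,
    LinearMap.add_apply, LinearMap.neg_apply, LinearMap.sum_apply, LinearMap.smul_apply,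
    Finset.sum_add_distrib, Finset.sum_neg_distrib, Finset.sum_sub_distrib, Finset.mul_sum]
  rw [Finset.sum_comm, Finset.sum_comm (s := (Finset.univ : Finset (Fin n))) (t := Finset.univ)
    (f := fun j i => ((1 / (2 * t₀)) • (x - x₀)) i • ip (D.curvature x i j) (C j))]
  simp only [PiLp.smul_apply, smul_eq_mul]
  ring

/-- The divergence of the vector field `⟨F_{i·}, B⟩ G`. -/
theorem divergence_ip_curvature (x₀ : Rn n) (t₀ : ℝ) {B : OneForm 𝕜 n r}
    (hB : ∀ j, EntrySmooth fun x => B x j) (x : Rn n) :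
    ∑ i, fderiv ℝ (fun y => (∑ j, ip (D.curvature y i j) (B y j)) * kernelG x₀ t₀ y) x
        (EuclideanSpace.single i 1) =
      (ipTwo (D.curvature x) (fun i j => D.covDeriv i (fun y => B y j) x)
        - ipOne (solitonOperator x₀ t₀ D x) (B x)) * kernelG x₀ t₀ x := by
  have hF := D.curvature_entrySmooth
  have hd : ∀ i j, DifferentiableAt ℝ (fun y => ip (D.curvature y i j) (B y j)) x :=
    fun i j => ((hF i j).ip (hB j)).differentiable (by simp) x
  rw [D.ipOne_solitonOperator, ipTwo, ← Finset.sum_sub_distrib, Finset.sum_mul]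
  refine Finset.sum_congr rfl fun i _ => ?_
  rw [fderiv_mul_kernelG (DifferentiableAt.fun_sum fun j _ => hd i j),
    fderiv_fun_sum fun j _ => hd i j, _root_.sum_apply]
  simp only [D.fderiv_ip_eq_covDeriv (hF i _) (hB _), Finset.sum_add_distrib]
  ring

variable {D} in
theorem contDiff_ip_curvature {B : OneForm 𝕜 n r} (hB : ∀ j, EntrySmooth fun x => B x j)
    (i : Fin n) : ContDiff ℝ ∞ fun y => ∑ j, ip (D.curvature y i j) (B y j) :=
  ContDiff.sum fun j _ => (D.curvature_entrySmooth i j).ip (hB j)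

/-- Integration by parts in the first variation formula. -/
theorem integral_ipTwo_curvature {x₀ : Rn n} {t₀ : ℝ} {B : OneForm 𝕜 n r}
    (hB : ∀ j, EntrySmooth fun x => B x j)
    (hint : ∀ i, Integrable fun y => (∑ j, ip (D.curvature y i j) (B y j)) * kernelG x₀ t₀ y)
    (hdiv : Integrable fun x => ipTwo (D.curvature x) (fun i j => D.covDeriv i (fun y => B y j) x)
      * kernelG x₀ t₀ x)
    (hsol : Integrable fun x => ipOne (solitonOperator x₀ t₀ D x) (B x) * kernelG x₀ t₀ x) :
    ∫ x, ipTwo (D.curvature x) (fun i j => D.covDeriv i (fun y => B y j) x) * kernelG x₀ t₀ x =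
      ∫ x, ipOne (solitonOperator x₀ t₀ D x) (B x) * kernelG x₀ t₀ x := by
  have h := integral_divergence_eq_zero
    (W := fun i y => (∑ j, ip (D.curvature y i j) (B y j)) * kernelG x₀ t₀ y)
    (fun i => ((contDiff_ip_curvature hB i).mul (kernelG_contDiff x₀ t₀)).of_le
      (WithTop.coe_le_coe.2 le_top)) hint
  simp only [D.divergence_ip_curvature x₀ t₀ hB, sub_mul] at h
  have := h (hdiv.sub hsol)
  rwa [integral_sub hdiv hsol, sub_eq_zero] at this

end Connection

/-- The affine vector field `a + c (x - x₀)`. -/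
def affineField (x₀ a : Rn n) (c : ℝ) (x : Rn n) : Rn n := a + c • (x - x₀)

theorem contDiff_affineField (x₀ a : Rn n) (c : ℝ) (k : Fin n) :
    ContDiff ℝ ∞ fun x => affineField x₀ a c x k := by
  unfold affineField
  fun_prop

theorem fderiv_affineField (x₀ a x : Rn n) (c : ℝ) (i k : Fin n) :
    fderiv ℝ (fun x => affineField x₀ a c x k) x (EuclideanSpace.single i 1) =
      if k = i then c else 0 := by
  have h : HasFDerivAt (fun x : Rn n => affineField x₀ a c x) _ x :=
    (((hasFDerivAt_id (𝕜 := ℝ) x).sub_const x₀).const_smul c).const_add a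
  have h2 : HasFDerivAt (fun x : Rn n => affineField x₀ a c x k) _ x :=
    (EuclideanSpace.proj (𝕜 := ℝ) k).hasFDerivAt.comp x h
  rw [h2.fderiv]
  simp

theorem norm_affineField_le (x₀ a x : Rn n) (c : ℝ) :
    ‖affineField x₀ a c x‖ ≤ (‖a‖ + |c|) * (1 + ‖x - x₀‖ ^ 2) := by
  refine (norm_add_le _ _).trans ?_
  rw [norm_smul, Real.norm_eq_abs]
  nlinarith [norm_nonneg a, abs_nonneg c, sq_nonneg (‖x - x₀‖ - 1),
    mul_nonneg (norm_nonneg a) (sq_nonneg ‖x - x₀‖),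
    mul_nonneg (abs_nonneg c) (sq_nonneg (‖x - x₀‖ - 1)),
    mul_nonneg (abs_nonneg c) (sq_nonneg ‖x - x₀‖)]

theorem hook_entrySmooth (D : Connection 𝕜 n r) {V : Rn n → Rn n}
    (hV : ∀ k, ContDiff ℝ ∞ fun x => V x k) (j : Fin n) :
    EntrySmooth fun x => hook V D.curvature x j :=
  EntrySmooth.sum fun k _ => EntrySmooth.smul (hV k) (D.curvature_entrySmooth k j)

namespace Connection

variable (D : Connection 𝕜 n r)

/-- The Jacobian of the affine field is c times the identity, so ∇ᵢ(V⌟F)ⱼ = cFᵢⱼ + Vᵏ∇ᵢFₖⱼ. The last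
term pairs with F to a quarter of the derivative of |F|² along V. -/
theorem ipTwo_covDeriv_hook (x₀ a : Rn n) (c : ℝ) (x : Rn n) :
    ipTwo (D.curvature x)
        (fun i j => D.covDeriv i (fun y => hook (affineField x₀ a c) D.curvature y j) x) =
      c * normSqTwo (D.curvature x) + 1 / 4 * ∑ k, affineField x₀ a c x k *
        fderiv ℝ (fun y => normSqTwo (D.curvature y)) x (EuclideanSpace.single k 1) := by
  have hF := D.curvature_entrySmooth
  have hV := contDiff_affineField x₀ a c
  have h : ∀ i j, D.covDeriv i (fun y => hook (affineField x₀ a c) D.curvature y j) x =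
      c • D.curvature x i j + ∑ k, affineField x₀ a c x k •
        D.covDeriv i (fun y => D.curvature y k j) x := by
    intro i j
    simp only [hook]
    rw [D.covDeriv_sum fun k _ => EntrySmooth.smul (hV k) (hF k j)]
    simp only [D.covDeriv_smul ((hV _).differentiable (by simp) x) (hF _ j),
      Finset.sum_add_distrib, fderiv_affineField, ite_smul, zero_smul, Finset.sum_ite_eq',
      Finset.mem_univ, if_true]
  simp only [h, D.fderiv_normSqTwo_curvature]
  simp only [← ipTwo_self]
  simp only [ipTwo, map_add, map_sum, map_smul, Finset.sum_add_distrib, smul_eq_mul,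
    Finset.mul_sum]
  congr 1
  rw [Finset.sum_congr rfl fun i _ => Finset.sum_comm, Finset.sum_comm]
  refine Finset.sum_congr rfl fun k _ => Finset.sum_congr rfl fun i _ =>
    Finset.sum_congr rfl fun j _ => ?_
  ring

/-- The divergence of the stress-energy field contracted with an affine vector field. -/
theorem divergence_stressEnergy (x₀ : Rn n) (t₀ : ℝ) (a : Rn n) (c : ℝ) (x : Rn n)
    (hsol : IsSoliton D x₀ t₀) :
    ∑ i, fderiv ℝ (fun y => (affineField x₀ a c y i * normSqTwo (D.curvature y)) * kernelG x₀ t₀ y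
        - 4 * ((∑ j, ip (D.curvature y i j) (hook (affineField x₀ a c) D.curvature y j))
          * kernelG x₀ t₀ y)) x (EuclideanSpace.single i 1) =
      (c * (n - 4) - inner ℝ (affineField x₀ a c x) (x - x₀) / (2 * t₀))
        * normSqTwo (D.curvature x) * kernelG x₀ t₀ x := by
  have hF := contDiff_normSqTwo D.curvature_entrySmooth
  have hV := contDiff_affineField x₀ a c
  have hB := hook_entrySmooth D hV
  have hG := kernelG_contDiff x₀ t₀
  have hdF := hF.differentiable (by simp) x
  have hdV : ∀ i, DifferentiableAt ℝ (fun y => affineField x₀ a c y i) x :=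
    fun i => (hV i).differentiable (by simp) x
  have h1 : ∀ i, DifferentiableAt ℝ (fun y => (affineField x₀ a c y i *
      normSqTwo (D.curvature y)) * kernelG x₀ t₀ y) x := fun i =>
    (((hV i).mul hF).mul hG).differentiable (by simp) x
  have h2 : ∀ i, DifferentiableAt ℝ (fun y => (∑ j, ip (D.curvature y i j)
      (hook (affineField x₀ a c) D.curvature y j)) * kernelG x₀ t₀ y) x := fun i =>
    ((contDiff_ip_curvature hB i).mul hG).differentiable (by simp) x
  -- The soliton equation enters only here.
  have hs : ipOne (solitonOperator x₀ t₀ D x) (hook (affineField x₀ a c) D.curvature x) = 0 := by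
    simp only [ipOne, hsol x, map_zero, LinearMap.zero_apply, Finset.sum_const_zero]
  have h3 : ∀ i, fderiv ℝ (fun y => (affineField x₀ a c y i * normSqTwo (D.curvature y))
        * kernelG x₀ t₀ y - 4 * ((∑ j, ip (D.curvature y i j)
          (hook (affineField x₀ a c) D.curvature y j)) * kernelG x₀ t₀ y)) x
        (EuclideanSpace.single i 1) =
      (c * normSqTwo (D.curvature x) + affineField x₀ a c x i *
        fderiv ℝ (fun y => normSqTwo (D.curvature y)) x (EuclideanSpace.single i 1)
        - 1 / (2 * t₀) * (x - x₀) i * (affineField x₀ a c x i * normSqTwo (D.curvature x)))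
          * kernelG x₀ t₀ x -
      4 * fderiv ℝ (fun y => (∑ j, ip (D.curvature y i j)
          (hook (affineField x₀ a c) D.curvature y j)) * kernelG x₀ t₀ y) x
        (EuclideanSpace.single i 1) := by
    intro i
    rw [fderiv_fun_sub (h1 i) ((h2 i).const_mul 4), fderiv_const_mul (h2 i),
      _root_.sub_apply, fderiv_mul_kernelG ((hdV i).fun_mul hdF), fderiv_fun_mul (hdV i) hdF]
    simp only [_root_.add_apply, _root_.smul_apply, fderiv_affineField, smul_eq_mul, if_true]
    ring
  have hin : inner ℝ (affineField x₀ a c x) (x - x₀) =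
      ∑ i, (x - x₀) i * affineField x₀ a c x i := by
    simp [PiLp.inner_apply]
  simp only [h3]
  rw [Finset.sum_sub_distrib, ← Finset.mul_sum, D.divergence_ip_curvature x₀ t₀ hB, hs,
    D.ipTwo_covDeriv_hook, ← Finset.sum_mul, hin]
  simp only [Finset.sum_sub_distrib, Finset.sum_add_distrib, Finset.sum_const, Finset.card_univ,
    Fintype.card_fin, nsmul_eq_mul]
  have h4 : ∑ i, 1 / (2 * t₀) * (x - x₀) i * (affineField x₀ a c x i * normSqTwo (D.curvature x))
      = (∑ i, (x - x₀) i * affineField x₀ a c x i) / (2 * t₀) * normSqTwo (D.curvature x) := by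
    rw [Finset.sum_div, Finset.sum_mul]
    exact Finset.sum_congr rfl fun i _ => by ring
  rw [h4]
  -- The derivatives of |F|² along V cancel because 4 · 1/4 = 1. The trace of the Jacobian gives cn,
  -- and the second field removes 4c.
  ring

end Connection

end Identities

/-! ### The two implications. -/

section Criticality

variable {𝕜 : Type*} [RCLike 𝕜] {n r : ℕ}

theorem abs_sum_ip_curvature_le (D : Connection 𝕜 n r) (B : Fin n → Matrix (Fin r) (Fin r) 𝕜)
    (x : Rn n) (i : Fin n) :
    |∑ j, ip (D.curvature x i j) (B j)| ≤ n * normSqTwo (D.curvature x) + normSqOne B := by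
  have h1 : ∀ j, |ip (D.curvature x i j) (B j)| ≤ normSqTwo (D.curvature x) + matNormSq (B j) := by
    intro j
    have h2 := abs_ip_le (D.curvature x i j) (B j)
    have h3 := matNormSq_le_normSqTwo (D.curvature x) i j
    have h4 := matNormSq_nonneg (B j)
    have h5 := normSqTwo_nonneg (D.curvature x)
    linarith
  calc _ ≤ _ := Finset.abs_sum_le_sum_abs _ _
    _ ≤ ∑ j, (normSqTwo (D.curvature x) + matNormSq (B j)) := Finset.sum_le_sum fun j _ => h1 j
    _ = _ := by simp [Finset.sum_add_distrib, normSqOne]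

theorem abs_sum_ip_hook_le (D : Connection 𝕜 n r) (V : Rn n → Rn n) (x : Rn n) (i : Fin n) :
    |∑ j, ip (D.curvature x i j) (hook V D.curvature x j)| ≤
      (n * n) * (‖V x‖ * normSqTwo (D.curvature x)) := by
  have h1 : ∀ j k, |V x k * ip (D.curvature x i j) (D.curvature x k j)| ≤
      ‖V x‖ * normSqTwo (D.curvature x) := by
    intro j k
    rw [abs_mul]
    refine mul_le_mul (PiLp.norm_apply_le (V x) k) ?_ (abs_nonneg _) (norm_nonneg _)
    have h2 := abs_ip_le (D.curvature x i j) (D.curvature x k j)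
    have h3 := matNormSq_le_normSqTwo (D.curvature x) i j
    have h4 := matNormSq_le_normSqTwo (D.curvature x) k j
    linarith
  simp only [hook, map_sum, map_smul, smul_eq_mul]
  calc _ ≤ _ := Finset.abs_sum_le_sum_abs _ _
    _ ≤ ∑ _j : Fin n, ∑ _k : Fin n, ‖V x‖ * normSqTwo (D.curvature x) :=
        Finset.sum_le_sum fun j _ =>
          (Finset.abs_sum_le_sum_abs _ _).trans (Finset.sum_le_sum fun k _ => h1 j k)
    _ = _ := by simp; ring

/-- The weighted energy identity satisfied by solitons, from the divergence of the stress-energy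
field. -/
theorem IsSoliton.integral_stressEnergy {D : Connection 𝕜 n r} {x₀ y : Rn n} {t₀ : ℝ}
    (hsol : IsSoliton D x₀ t₀) (ht₀ : 0 < t₀) (hgrowth : PolynomialEnergyGrowth D y)
    (a : Rn n) (c : ℝ) :
    ∫ x, (c * (n - 4) - inner ℝ (affineField x₀ a c x) (x - x₀) / (2 * t₀))
        * normSqTwo (D.curvature x) * kernelG x₀ t₀ x = 0 := by
  have hFE := hgrowth.integrable_gaussian x₀ (T := 2 * t₀) (by linarith)
  have hT : t₀ < 2 * t₀ := by linarith
  have hF := D.continuous_normSqTwo_curvature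
  have hV := contDiff_affineField x₀ a c
  have hVc : Continuous (affineField x₀ a c) := by unfold affineField; fun_prop
  have hB := hook_entrySmooth D hV
  have hG := kernelG_contDiff x₀ t₀
  set M := ‖a‖ + |c| with hM
  have hM0 : 0 ≤ M := by positivity
  have hVF : ∀ x, ‖affineField x₀ a c x‖ * normSqTwo (D.curvature x) ≤
      (1 + ‖x - x₀‖ ^ 2) * (M * normSqTwo (D.curvature x)) := fun x => by
    have := mul_le_mul_of_nonneg_right (norm_affineField_le x₀ a x c)
      (normSqTwo_nonneg (D.curvature x))
    linarith
  have hint1 : ∀ i, Integrable fun x => (affineField x₀ a c x i * normSqTwo (D.curvature x))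
      * kernelG x₀ t₀ x := by
    intro i
    refine integrable_mul_kernelG_of_bound (b := fun x => M * normSqTwo (D.curvature x))
      ((hV i).continuous.mul hF) x₀ ht₀ hT ((hFE.const_mul M).congr
        (Filter.Eventually.of_forall fun x => by simp only; ring)) fun x => ?_
    rw [Pi.mul_apply, abs_mul, abs_of_nonneg (normSqTwo_nonneg _)]
    exact (mul_le_mul_of_nonneg_right (PiLp.norm_apply_le (affineField x₀ a c x) i)
      (normSqTwo_nonneg _)).trans (hVF x)
  have hint2 : ∀ i, Integrable fun x => (∑ j, ip (D.curvature x i j)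
      (hook (affineField x₀ a c) D.curvature x j)) * kernelG x₀ t₀ x := by
    intro i
    refine integrable_mul_kernelG_of_bound
      (b := fun x => n * n * (M * normSqTwo (D.curvature x)))
      (Connection.contDiff_ip_curvature hB i).continuous x₀ ht₀ hT ((hFE.const_mul (n * n * M)).congr
        (Filter.Eventually.of_forall fun x => by simp only; ring)) fun x => ?_
    refine (abs_sum_ip_hook_le D _ x i).trans ?_
    have := mul_le_mul_of_nonneg_left (hVF x) (show (0 : ℝ) ≤ n * n by positivity)
    linarith
  have hdiv : Integrable fun x => (c * (n - 4) - inner ℝ (affineField x₀ a c x) (x - x₀)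
      / (2 * t₀)) * normSqTwo (D.curvature x) * kernelG x₀ t₀ x := by
    set L := |c * ((n : ℝ) - 4)| + M / t₀ with hL
    refine integrable_mul_kernelG_of_bound (b := fun x => L * normSqTwo (D.curvature x))
      (Continuous.mul (by fun_prop) hF) x₀ ht₀ hT ((hFE.const_mul L).congr
        (Filter.Eventually.of_forall fun x => by simp only; ring)) fun x => ?_
    rw [Pi.mul_apply, abs_mul, abs_of_nonneg (normSqTwo_nonneg _), ← mul_assoc]
    refine mul_le_mul_of_nonneg_right ?_ (normSqTwo_nonneg _)
    set u := ‖x - x₀‖ with hu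
    have hu0 : 0 ≤ u := norm_nonneg _
    have hin : |inner ℝ (affineField x₀ a c x) (x - x₀)| ≤ 2 * (M * (1 + u ^ 2)) := by
      refine (abs_real_inner_le_norm _ _).trans ?_
      -- Here the linear growth of the field is needed: it is multiplied by u, and the product must
      -- stay quadratic.
      have h1 : ‖affineField x₀ a c x‖ ≤ ‖a‖ + |c| * u := by
        refine (norm_add_le _ _).trans ?_
        rw [norm_smul, Real.norm_eq_abs]
      refine (mul_le_mul_of_nonneg_right h1 hu0).trans ?_
      rw [hM]
      nlinarith [norm_nonneg a, abs_nonneg c, mul_nonneg (norm_nonneg a) (sq_nonneg (u - 1)),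
        mul_nonneg (norm_nonneg a) (sq_nonneg u), mul_nonneg (abs_nonneg c) (sq_nonneg u)]
    have h2 : |inner ℝ (affineField x₀ a c x) (x - x₀) / (2 * t₀)| ≤ M / t₀ * (1 + u ^ 2) := by
      rw [abs_div, abs_of_pos (show 0 < 2 * t₀ by positivity), div_le_iff₀ (by positivity)]
      refine hin.trans (le_of_eq ?_)
      field_simp
    refine (abs_sub _ _).trans ?_
    have h3 : |c * ((n : ℝ) - 4)| ≤ |c * ((n : ℝ) - 4)| * (1 + u ^ 2) :=
      le_mul_of_one_le_right (abs_nonneg _) (by nlinarith [sq_nonneg u])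
    rw [hL]
    linarith
  have h := integral_divergence_eq_zero
    (W := fun i y => (affineField x₀ a c y i * normSqTwo (D.curvature y)) * kernelG x₀ t₀ y
        - 4 * ((∑ j, ip (D.curvature y i j) (hook (affineField x₀ a c) D.curvature y j))
          * kernelG x₀ t₀ y))
    (fun i => ((((hV i).mul (contDiff_normSqTwo D.curvature_entrySmooth)).mul hG).sub
      (contDiff_const.mul ((Connection.contDiff_ip_curvature hB i).mul hG))).of_le
        (WithTop.coe_le_coe.2 le_top))
    (fun i => (hint1 i).sub ((hint2 i).const_mul 4))
  simp only [D.divergence_stressEnergy x₀ t₀ a c _ hsol] at h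
  exact h hdiv

/-- The first variation formula, before integration by parts. -/
theorem Variation.hasDerivAt_functionalF {D : Connection 𝕜 n r} {x₀ y : Rn n} {t₀ : ℝ}
    (ht₀ : 0 < t₀) (hgrowth : PolynomialEnergyGrowth D y) (v : Variation D x₀ t₀) :
    HasDerivAt (fun s => functionalF (v.conn s) (v.point s) (v.time s))
      (2 * t₀ * deriv v.time 0 * (∫ x, normSqTwo (D.curvature x) * kernelG x₀ t₀ x) +
        t₀ ^ 2 * ∫ x, (2 * ipTwo (D.curvature x) (curvatureVelocity v.conn 0 x)
          * kernelG x₀ t₀ x + normSqTwo (D.curvature x) *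
          (kernelG x₀ t₀ x * kernelRate x₀ (deriv v.point 0) t₀ (deriv v.time 0) x))) 0 := by
  have h1 := ((v.time_smooth.differentiable (by simp) 0).hasDerivAt.fun_pow 2).mul
    (v.hasDerivAt_integral ht₀ hgrowth)
  refine h1.congr_deriv ?_
  simp only [v.conn_zero, v.point_zero, v.time_zero]
  ring

/-- These are the integrability hypotheses of the integration by parts: the bound on ∂ₛF controls
the divergence term, and the bound on ∂ₛΓ controls the flux. -/
theorem Variation.integrable_ipTwo {D : Connection 𝕜 n r} {x₀ y : Rn n} {t₀ : ℝ}
    (ht₀ : 0 < t₀) (hgrowth : PolynomialEnergyGrowth D y) (v : Variation D x₀ t₀) :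
    (Integrable fun x => ipTwo (D.curvature x) (curvatureVelocity v.conn 0 x)
      * kernelG x₀ t₀ x) ∧ ∀ i, Integrable fun x =>
        (∑ j, ip (D.curvature x i j) (velocity v.conn 0 x j)) * kernelG x₀ t₀ x := by
  obtain ⟨ε, T, h, hε, hT, hint, hbd⟩ := v.admissible
  have hFE := hgrowth.integrable_gaussian x₀ (ht₀.trans hT)
  have hb := fun x => hbd 0 (by simpa) x
  have hu : ∀ x, 1 ≤ 1 + ‖x - x₀‖ ^ 2 := fun x => by nlinarith [sq_nonneg ‖x - x₀‖]
  have hB := velocity_entrySmooth v.conn_smooth 0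
  constructor
  · refine integrable_mul_kernelG_of_bound (b := fun x => normSqTwo (D.curvature x) + h x)
      (contDiff_ipTwo D.curvature_entrySmooth
        (curvatureVelocity_entrySmooth v.conn_smooth 0)).continuous x₀ ht₀ hT
      ((hFE.add hint).congr (Filter.Eventually.of_forall fun x => by
        simp only [Pi.add_apply]; ring)) fun x => ?_
    have h1 := two_mul_abs_ipTwo_le (D.curvature x) (curvatureVelocity v.conn 0 x)
    have h2 := (hb x).2
    have h3 := abs_nonneg (ipTwo (D.curvature x) (curvatureVelocity v.conn 0 x))
    exact le_trans (by linarith) (le_mul_of_one_le_left (by linarith) (hu x))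
  · intro i
    refine integrable_mul_kernelG_of_bound (b := fun x => n * normSqTwo (D.curvature x) + h x)
      (Connection.contDiff_ip_curvature hB i).continuous x₀ ht₀ hT
      (((hFE.const_mul n).add hint).congr (Filter.Eventually.of_forall fun x => by
        simp only [Pi.add_apply]; ring)) fun x => ?_
    have h1 := abs_sum_ip_curvature_le D (velocity v.conn 0 x) x i
    have h2 := (hb x).1
    have h3 := abs_nonneg (∑ j, ip (D.curvature x i j) (velocity v.conn 0 x j))
    exact le_trans (by linarith) (le_mul_of_one_le_left (by linarith) (hu x))

/-- The first variation in the direction of the connection. -/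
theorem Variation.integral_ipTwo_curvatureVelocity {D : Connection 𝕜 n r} {x₀ y : Rn n} {t₀ : ℝ}
    (ht₀ : 0 < t₀) (hgrowth : PolynomialEnergyGrowth D y) (v : Variation D x₀ t₀)
    (hsol : Integrable fun x => ipOne (solitonOperator x₀ t₀ D x) (velocity v.conn 0 x)
      * kernelG x₀ t₀ x) :
    ∫ x, ipTwo (D.curvature x) (curvatureVelocity v.conn 0 x) * kernelG x₀ t₀ x =
      2 * ∫ x, ipOne (solitonOperator x₀ t₀ D x) (velocity v.conn 0 x) * kernelG x₀ t₀ x := by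
  obtain ⟨h1, h2⟩ := v.integrable_ipTwo ht₀ hgrowth
  have h3 : ∀ x, ipTwo (D.curvature x) (curvatureVelocity v.conn 0 x) = 2 *
      ipTwo (D.curvature x) (fun i j => D.covDeriv i (fun y => velocity v.conn 0 y j) x) := by
    intro x
    rw [← ipTwo_sub_swap (D.curvature_antisymm x)
      (fun i j => D.covDeriv i (fun y => velocity v.conn 0 y j) x)]
    congr 1
    ext1 i; ext1 j
    rw [curvatureVelocity_eq_covDeriv v.conn_smooth, v.conn_zero]
  simp only [h3, mul_assoc] at h1 ⊢
  have h4 := (h1.const_mul (1 / 2)).congr (g := fun x => ipTwo (D.curvature x)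
    (fun i j => D.covDeriv i (fun y => velocity v.conn 0 y j) x) * kernelG x₀ t₀ x)
    (Filter.Eventually.of_forall fun x => by simp only; ring)
  rw [integral_const_mul, D.integral_ipTwo_curvature (velocity_entrySmooth v.conn_smooth 0)
    h2 h4 hsol]

theorem IsSoliton.isCriticalPoint {D : Connection 𝕜 n r} {x₀ y : Rn n} {t₀ : ℝ}
    (hsol : IsSoliton D x₀ t₀) (ht₀ : 0 < t₀) (hgrowth : PolynomialEnergyGrowth D y) :
    IsCriticalPoint D x₀ t₀ := by
  intro v
  refine (v.hasDerivAt_functionalF ht₀ hgrowth).congr_deriv ?_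
  have hz : ∀ x, ipOne (solitonOperator x₀ t₀ D x) (velocity v.conn 0 x) = 0 := fun x => by
    simp only [ipOne, hsol x, map_zero, LinearMap.zero_apply, Finset.sum_const_zero]
  have h1 := v.integral_ipTwo_curvatureVelocity ht₀ hgrowth (by simp [hz])
  simp only [hz, zero_mul, integral_zero, mul_zero] at h1
  have hi1 := (v.integrable_ipTwo ht₀ hgrowth).1
  set w := deriv v.point 0
  set τ := deriv v.time 0
  -- Matching coefficients with the first variation: the term linear in x - x₀ forces a = -t₀²w and
  -- the quadratic term forces c = -t₀τ/2. The constants then agree, since c(n - 4) = 2t₀τ - nt₀τ/2.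
  have h2 := hsol.integral_stressEnergy ht₀ hgrowth (-t₀ ^ 2 • w) (-(t₀ * τ) / 2)
  have h3 : ∀ x, (-(t₀ * τ) / 2 * (n - 4) - inner ℝ (affineField x₀ (-t₀ ^ 2 • w)
      (-(t₀ * τ) / 2) x) (x - x₀) / (2 * t₀)) * normSqTwo (D.curvature x) * kernelG x₀ t₀ x =
      2 * t₀ * τ * (normSqTwo (D.curvature x) * kernelG x₀ t₀ x) + t₀ ^ 2 *
        (normSqTwo (D.curvature x) * (kernelG x₀ t₀ x * kernelRate x₀ w t₀ τ x)) := by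
    intro x
    rw [affineField, inner_add_left, inner_smul_left, inner_smul_left,
      real_inner_self_eq_norm_sq, real_inner_comm, kernelRate]
    simp only [conj_trivial]
    field_simp
    ring
  simp only [h3] at h2
  have hF := D.continuous_normSqTwo_curvature
  have hFE := hgrowth.integrable_gaussian x₀ (T := 2 * t₀) (by linarith)
  have hT : t₀ < 2 * t₀ := by linarith
  have hi2 : Integrable fun x => normSqTwo (D.curvature x) * kernelG x₀ t₀ x := by
    refine integrable_mul_kernelG_of_bound hF x₀ ht₀ hT hFE fun x => ?_
    rw [abs_of_nonneg (normSqTwo_nonneg _)]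
    exact le_mul_of_one_le_left (normSqTwo_nonneg _) (by nlinarith [sq_nonneg ‖x - x₀‖])
  have hi3 : Integrable fun x =>
      normSqTwo (D.curvature x) * (kernelG x₀ t₀ x * kernelRate x₀ w t₀ τ x) := by
    set K := ‖w‖ + |τ|
    set L := n * K / t₀ + K / t₀ + K / t₀ ^ 2 with hL
    refine (integrable_mul_kernelG_of_bound (g := fun x => normSqTwo (D.curvature x) *
      kernelRate x₀ w t₀ τ x) (b := fun x => L * normSqTwo (D.curvature x))
      (hF.mul (continuous_kernelRate _ _ _ _)) x₀ ht₀ hT ((hFE.const_mul L).congr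
        (Filter.Eventually.of_forall fun x => by simp only; ring)) fun x => ?_).congr
        (Filter.Eventually.of_forall fun x => by simp only; ring)
    have h4 := abs_kernelRate_le (z := x₀) (w := w) (τ := τ) (K := K) ht₀ le_rfl
      (le_add_of_nonneg_right (abs_nonneg _)) (le_add_of_nonneg_left (norm_nonneg _)) x
    rw [← hL] at h4
    rw [abs_mul, abs_of_nonneg (normSqTwo_nonneg _)]
    have := mul_le_mul_of_nonneg_left h4 (normSqTwo_nonneg (D.curvature x))
    linarith
  rw [integral_add (hi2.const_mul _) (hi3.const_mul _), integral_const_mul,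
    integral_const_mul] at h2
  have h5 : ∫ x, 2 * ipTwo (D.curvature x) (curvatureVelocity v.conn 0 x) * kernelG x₀ t₀ x = 0 := by
    simp only [mul_assoc]
    rw [integral_const_mul, h1, mul_zero]
  rw [integral_add (by simpa only [mul_assoc] using hi1.const_mul 2) hi3, h5, zero_add]
  exact h2

/-- Families of connections that are constant outside a compact set, with fixed `x₀` and `t₀`,
are variations. -/
def Variation.ofCompact {D : Connection 𝕜 n r} (x₀ : Rn n) {t₀ : ℝ} (ht₀ : 0 < t₀)
    (conn : ℝ → Connection 𝕜 n r) (hzero : conn 0 = D)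
    (hc : ∀ i β α, ContDiff ℝ ∞ fun q : ℝ × Rn n => (conn q.1).coeff q.2 i β α)
    {K : Set (Rn n)} (hK : IsCompact K) (hout : ∀ s, ∀ x ∉ K, (conn s).coeff x = D.coeff x) :
    Variation D x₀ t₀ where
  conn := conn
  point _ := x₀
  time _ := t₀
  conn_zero := hzero
  point_zero := rfl
  time_zero := rfl
  conn_smooth := hc
  point_smooth := contDiff_const
  time_smooth := contDiff_const
  time_pos _ := ht₀
  admissible := by
    have hcontB : Continuous fun q : ℝ × Rn n => normSqOne (velocity conn q.1 q.2) := by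
      have h : ∀ i β α, Continuous fun q : ℝ × Rn n => velocity conn q.1 q.2 i β α := by
        intro i β α
        have : (fun q : ℝ × Rn n => velocity conn q.1 q.2 i β α) = fun q =>
            fderiv ℝ (fun q : ℝ × Rn n => (conn q.1).coeff q.2 i β α) q (1, 0) := by
          ext q; exact (hasDerivAt_slice (hc i β α) q.1 q.2).deriv
        rw [this]
        exact (contDiff_fderiv_apply (hc i β α) _).continuous
      simp only [normSqOne, matNormSq]
      fun_prop
    have hcontF : Continuous fun q : ℝ × Rn n => normSqTwo (curvatureVelocity conn q.1 q.2) := by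
      have h : ∀ i j β α, Continuous fun q : ℝ × Rn n =>
          curvatureVelocity conn q.1 q.2 i j β α := by
        intro i j β α
        have : (fun q : ℝ × Rn n => curvatureVelocity conn q.1 q.2 i j β α) = fun q =>
            fderiv ℝ (fun q : ℝ × Rn n => (conn q.1).curvature q.2 i j β α) q (1, 0) := by
          ext q; exact (hasDerivAt_slice (curvature_contDiff_family hc i j β α) q.1 q.2).deriv
        rw [this]
        exact (contDiff_fderiv_apply (curvature_contDiff_family hc i j β α) _).continuous
      simp only [normSqTwo, matNormSq]
      fun_prop
    obtain ⟨M, hM⟩ := ((isCompact_Icc (a := (-1 : ℝ)) (b := 1)).prod hK).exists_bound_of_continuousOn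
      (hcontB.add hcontF).continuousOn
    -- The bound `M` comes from compactness of [-1, 1] × K, hence ε = 1; any scale above t₀ would
    -- do, because h vanishes off K.
    refine ⟨1, t₀ + 1, K.indicator fun _ => M, one_pos, by linarith, ?_, fun s hs x => ?_⟩
    · have hE : Continuous fun x : Rn n => M * Real.exp (-‖x - x₀‖ ^ 2 / (4 * (t₀ + 1))) := by
        fun_prop
      have h := (hE.continuousOn.integrableOn_compact (μ := volume) hK).integrable_indicator
        hK.measurableSet
      refine h.congr (Filter.Eventually.of_forall fun x => ?_)
      by_cases hx : x ∈ K <;> simp [hx]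
    · by_cases hx : x ∈ K
      · rw [Set.indicator_of_mem hx]
        have h := hM (s, x) ⟨Set.mem_Icc.2 (abs_le.1 hs.le), hx⟩
        have h1 : normSqOne (velocity conn s x) + normSqTwo (curvatureVelocity conn s x) ≤ M :=
          (Real.le_norm_self _).trans h
        have h2 := normSqOne_nonneg (velocity conn s x)
        have h3 := normSqTwo_nonneg (curvatureVelocity conn s x)
        constructor <;> linarith
      · rw [Set.indicator_of_notMem hx]
        have h1 : velocity conn s x = 0 := by
          ext i β α
          simp [velocity, hout _ x hx]
        -- The curvature involves derivatives of Γ, so agreement on a neighbourhood is needed; the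
        -- complement of K is open.
        have hnear : ∀ᶠ y in nhds x, y ∉ K := hK.isClosed.isOpen_compl.mem_nhds hx
        have h2 : curvatureVelocity conn s x = 0 := by
          have : ∀ σ, (conn σ).curvature x = D.curvature x := by
            intro σ
            ext1 i; ext1 j
            have h : ∀ i j, pderiv i (fun y => (conn σ).coeff y j) x =
                pderiv i (fun y => D.coeff y j) x := fun i j =>
              pderiv_congr (hnear.mono fun y hy => by simp only [hout σ y hy]) i
            simp only [Connection.curvature, h, hout σ x hx]
          ext i j β α
          simp [curvatureVelocity, this]
        rw [h1, h2]
        simp [normSqOne, normSqTwo, matNormSq]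

theorem solitonOperator_entrySmooth (D : Connection 𝕜 n r) (x₀ : Rn n) (t₀ : ℝ) (j : Fin n) :
    EntrySmooth fun x => solitonOperator x₀ t₀ D x j :=
  (EntrySmooth.sum fun i _ => D.covDeriv_entrySmooth (D.curvature_entrySmooth i j) i).neg.add
    (hook_entrySmooth D (fun k => by fun_prop) j)

theorem solitonOperator_skew (D : Connection 𝕜 n r) (x₀ : Rn n) (t₀ : ℝ) (x : Rn n) (j : Fin n) :
    (solitonOperator x₀ t₀ D x j)ᴴ = -solitonOperator x₀ t₀ D x j := by
  simp only [solitonOperator, Connection.adjoint, hook, Matrix.conjTranspose_add,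
    Matrix.conjTranspose_neg, Matrix.conjTranspose_sum, Matrix.conjTranspose_smul,
    D.covDeriv_skew fun y => D.curvature_skew y _ j, D.curvature_skew, star_trivial,
    smul_neg, Finset.sum_neg_distrib, neg_add]

/-- The family `∇ + s φ (D^*F + ((x - x₀) / 2t₀) ⌟ F)` for a cutoff function `φ`. -/
def solitonFamily (D : Connection 𝕜 n r) (x₀ : Rn n) (t₀ : ℝ) {φ : Rn n → ℝ}
    (hφ : ContDiff ℝ ∞ φ) (s : ℝ) : Connection 𝕜 n r where
  coeff x i := D.coeff x i + s • φ x • solitonOperator x₀ t₀ D x i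
  smooth i := (D.entrySmooth i).add (EntrySmooth.smul contDiff_const
    (EntrySmooth.smul hφ (solitonOperator_entrySmooth D x₀ t₀ i)))
  skew x i := by
    simp only [Matrix.conjTranspose_add, Matrix.conjTranspose_smul, D.skew, star_trivial,
      solitonOperator_skew, smul_neg, neg_add]

theorem IsCriticalPoint.isSoliton {D : Connection 𝕜 n r} {x₀ y : Rn n} {t₀ : ℝ}
    (hcrit : IsCriticalPoint D x₀ t₀) (ht₀ : 0 < t₀) (hgrowth : PolynomialEnergyGrowth D y) :
    IsSoliton D x₀ t₀ := by
  intro x₁ j₁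
  -- The bump localises the test direction φS at the point where S is to vanish; compact support
  -- makes the variation admissible without any growth bound on S.
  let φ : ContDiffBump x₁ := ⟨1, 2, one_pos, one_lt_two⟩
  have hφ : ContDiff ℝ ∞ φ := φ.contDiff
  have hS := solitonOperator_entrySmooth D x₀ t₀
  let v : Variation D x₀ t₀ := Variation.ofCompact x₀ ht₀ (solitonFamily D x₀ t₀ hφ)
    (by cases D; simp [solitonFamily])
    (fun i β α => by
      simp only [solitonFamily, Matrix.add_apply, Matrix.smul_apply]
      exact ((D.smooth i β α).comp contDiff_snd).add
        (contDiff_fst.smul ((hφ.comp contDiff_snd).smul ((hS i β α).comp contDiff_snd))))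
    φ.hasCompactSupport.isCompact
    (fun s x hx => by
      ext1 i
      simp [solitonFamily, image_eq_zero_of_notMem_tsupport hx])
  have hvel : ∀ x, velocity v.conn 0 x = fun i => φ x • solitonOperator x₀ t₀ D x i := by
    intro x
    ext i β α
    have h : HasDerivAt (fun σ : ℝ => D.coeff x i β α +
        σ • (φ x • solitonOperator x₀ t₀ D x i β α)) _ 0 :=
      ((hasDerivAt_id (0 : ℝ)).smul_const (φ x • solitonOperator x₀ t₀ D x i β α)).const_add _
    exact h.deriv.trans (by simp)
  have hip : ∀ x, ipOne (solitonOperator x₀ t₀ D x) (velocity v.conn 0 x) * kernelG x₀ t₀ x =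
      φ x * (normSqOne (solitonOperator x₀ t₀ D x) * kernelG x₀ t₀ x) := by
    intro x
    rw [hvel, ← ipOne_self]
    simp only [ipOne, map_smul, smul_eq_mul, ← Finset.mul_sum]
    ring
  have hcont : Continuous fun x =>
      φ x * (normSqOne (solitonOperator x₀ t₀ D x) * kernelG x₀ t₀ x) :=
    hφ.continuous.mul ((contDiff_normSqOne hS).continuous.mul (kernelG_contDiff x₀ t₀).continuous)
  have hint : Integrable fun x =>
      φ x * (normSqOne (solitonOperator x₀ t₀ D x) * kernelG x₀ t₀ x) :=
    hcont.integrable_of_hasCompactSupport φ.hasCompactSupport.mul_right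
  have h1 := v.integral_ipTwo_curvatureVelocity ht₀ hgrowth (by simpa only [hip] using hint)
  have h2 := (v.hasDerivAt_functionalF ht₀ hgrowth).unique (hcrit v)
  have hp : deriv v.point 0 = 0 := deriv_const _ _
  have ht : deriv v.time 0 = 0 := deriv_const _ _
  have hr : ∀ x, kernelRate x₀ 0 t₀ 0 x = 0 := fun x => by simp [kernelRate]
  simp only [hp, ht, hr, mul_zero, zero_mul, add_zero, zero_add, mul_assoc] at h2
  rw [integral_const_mul, h1] at h2
  simp only [hip] at h2
  have h3 : ∫ x, φ x * (normSqOne (solitonOperator x₀ t₀ D x) * kernelG x₀ t₀ x) = 0 := by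
    have : t₀ ^ 2 ≠ 0 := by positivity
    simpa [this] using h2
  have hnn : ∀ x, 0 ≤ φ x * (normSqOne (solitonOperator x₀ t₀ D x) * kernelG x₀ t₀ x) := fun x =>
    mul_nonneg φ.nonneg (mul_nonneg (normSqOne_nonneg _) (kernelG_pos x₀ ht₀ x).le)
  -- A continuous nonnegative function with zero integral vanishes everywhere; it is then evaluated
  -- at the centre of the bump, where φ = 1 and the kernel is positive.
  rw [integral_eq_zero_iff_of_nonneg hnn hint, hcont.ae_eq_iff_eq _ continuous_zero] at h3
  have h4 := congrFun h3 x₁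
  simp only [φ.one_of_mem_closedBall (Metric.mem_closedBall_self one_pos.le), one_mul,
    Pi.zero_apply, mul_eq_zero, (kernelG_pos x₀ ht₀ x₁).ne', or_false] at h4
  apply matNormSq_eq_zero
  exact le_antisymm ((matNormSq_le_normSqOne _ j₁).trans h4.le) (matNormSq_nonneg _)

end Criticality

end YangMillsSoliton
end

theorem mainTheorem7 {𝕜 : Type*} [RCLike 𝕜] (n r : ℕ)
    (D : YangMillsSoliton.Connection 𝕜 n r) (x₀ : EuclideanSpace ℝ (Fin n)) (t₀ : ℝ)
    (ht₀ : 0 < t₀) (y : EuclideanSpace ℝ (Fin n))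
    (hgrowth : YangMillsSoliton.PolynomialEnergyGrowth D y) :
    YangMillsSoliton.IsCriticalPoint D x₀ t₀ ↔ YangMillsSoliton.IsSoliton D x₀ t₀ :=
  ⟨fun h => h.isSoliton ht₀ hgrowth, fun h => h.isCriticalPoint ht₀ hgrowth⟩
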